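/- \textbf{Conventions.} Let $n,m\ge 1$. Functions on $\mathbb R^n$ are Lebesgue measurable and real- or complex-valued; $B=B(y,r)$ denotes an open Euclidean ball and $\lambda B=B(y,\lambda r)$. A weight is a measurable function which is positive and finite almost everywhere; $\omega(E)=\int_E\omega\,dx$. For $1\le p<\infty$, $\omega\in A_p$ means $$\sup_B\Big(\frac1{|B|}\int_B\omega\Big)^{1/p}\Big(\frac1{|B|}\int_B\omega^{1-p'}\Big)^{1/p'}<\infty ,\qquad p'=\tfrac{p}{p-1},$$ and $A_\infty=\bigcup_{1\le p<\infty}A_p$. For $\vec P=(p_1,\dots,p_m)$ with $1\le p_j<\infty$ and $1/p=\sum_j1/p_j$, $\vec\omega=(\omega_1,\dots,\omega_m)\in A_{\vec P}$ means $$\sup_B\Big(\frac1{|B|}\int_B\nu_{\vec\omega}\Big)^{1/p}\prod_{j=1}^m\Big(\frac1{|B|}\int_B\omega_j^{1-p_j'}\Big)^{1/p_j'}<\infty,\qquad \nu_{\vec\omega}=\prod_{j=1}^m\omega_j^{p/p_j}.$$ When $p=1$ (resp. $p_j=1$) the factor with the conjugate exponent is understood as $(\operatorname{ess\,inf}_B\omega)^{-1}$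 (resp. $(\operatorname{ess\,inf}_B\omega_j)^{-1}$). For $0<q<\infty$ put $\|f\|_{L^q(\omega)}=(\int|f|^q\omega)^{1/q}$ and $\|f\|_{L^{q,\infty}(\omega)}=\sup_{t>0}t\,\omega(\{|f|>t\})^{1/q}$. For $0<q\le\alpha\le p\le\infty$, $(L^q(\omega),L^p)^\alpha$ is the space of all measurable $f$ with $$\|f\|_{(L^q(\omega),L^p)^\alpha}=\sup_{r>0}\Big\|\,y\mapsto\omega(B(y,r))^{\frac1\alpha-\frac1q-\frac1p}\,\|f\chi_{B(y,r)}\|_{L^q(\omega)}\Big\|_{L^p(\mathbb R^n,dy)}<\infty,$$ where $1/\infty=0$; $(L^{q,\infty}(\omega),L^p)^\alpha$ is defined in the same way with $\|f\chi_{B(y,r)}\|_{L^{q,\infty}(\omega)}$ in place of $\|f\chi_{B(y,r)}\|_{L^q(\omega)}$. An operator $\mathcal T$ is bounded from a product $X_1\times\cdots\times X_m$ to $Y$ if there is a finite constant $C$ with $\mathcal T(\vec f)\in Y$ and $\|\mathcal T(\vec f)\|_Y\le C\prod_j\|f_j\|_{X_j}$ for all $f_j\in X_j$. \textbf{Theorem.}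 Let $1\le s\le q_j\le\alpha_j<p_j\le\infty$ for $j=1,\dots,m$, let $$\frac1q=\sum_{j=1}^m\frac1{q_j},\qquad \frac1p=\sum_{j=1}^m\frac1{p_j},\qquad \frac1\alpha=\sum_{j=1}^m\frac1{\alpha_j},$$ and suppose that $p/p_j=q/q_j=\alpha/\alpha_j$ for all $j$ (the relation $p/p_j=q/q_j$ being read as $\frac1{p_j}=\frac{q}{q_j}\cdot\frac1p$, so that either all $p_j$ are finite or $p=p_1=\dots=p_m=\infty$). Put $\nu_{\vec\omega}=\prod_{j}\omega_j^{q/q_j}$ and let $\vec\omega\in A_{\vec Q/s}$, $\vec Q/s=(q_1/s,\dots,q_m/s)$, with $\omega_j\in A_\infty$ for every $j$. Let $D_j=L^{q_j}(\omega_j)+(L^{q_j}(\omega_j),L^{p_j})^{\alpha_j}$ and let $\mathcal T$ be an $m$-sublinear operator defined on $D_1\times\cdots\times D_m$: it takes its values in the measurable functions, and $|\mathcal T|$ is, almost everywhere, subadditive and absolutely homogeneous in each variable. Suppose that there is a constant $C_1$ such that for all $f_j\in D_j$ $(j=1,\dots,m)$, every nonempty $\sigma\subset\{1,\dots,m\}$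 with complement $\sigma^c$, every ball $B$ and almost every $x\in B$, $$\big|\mathcal T(f_1^{d_1},\dots,f_m^{d_m})(x)\big|\le C_1\prod_{j\in\sigma^c}\Big(\frac1{|2B|}\int_{2B}|f_j|^s\Big)^{1/s}\sum_{k=1}^\infty\frac{k}{2^{nk|\sigma^c|}}\prod_{j\in\sigma}\Big(\frac1{|2^{k+1}B|}\int_{2^{k+1}B\setminus2^kB}|f_j|^s\Big)^{1/s},$$ where $f_j^{d_j}=f_j\chi_{\mathbb R^n\setminus 2B}$ if $j\in\sigma$ and $f_j^{d_j}=f_j\chi_{2B}$ if $j\in\sigma^c$. Then: (i) if $q_j>1$ for all $j$ and $\mathcal T$ is bounded from $L^{q_1}(\omega_1)\times\cdots\times L^{q_m}(\omega_m)$ to $L^q(\nu_{\vec\omega})$, then $\mathcal T$ is bounded from $(L^{q_1}(\omega_1),L^{p_1})^{\alpha_1}\times\cdots\times(L^{q_m}(\omega_m),L^{p_m})^{\alpha_m}$ to $(L^q(\nu_{\vec\omega}),L^p)^\alpha$; (ii) if $q_j=1$ for some $j$ and $\mathcal T$ is bounded from $L^{q_1}(\omega_1)\times\cdots\times L^{q_m}(\omega_m)$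 to $L^{q,\infty}(\nu_{\vec\omega})$, then $\mathcal T$ is bounded from $(L^{q_1}(\omega_1),L^{p_1})^{\alpha_1}\times\cdots\times(L^{q_m}(\omega_m),L^{p_m})^{\alpha_m}$ to $(L^{q,\infty}(\nu_{\vec\omega}),L^p)^\alpha$. -/

import Mathlib

open MeasureTheory Metric
open scoped ENNReal NNReal

noncomputable section

namespace WeightedAmalgam

/-- The Euclidean space `ℝⁿ`. -/
abbrev Rn (n : ℕ) : Type := EuclideanSpace ℝ (Fin n)

/-! ### Weights -/

/-- A weight: a (Lebesgue) measurable function which is positive and finite almost everywhere.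
Local integrability is not listed, since it follows from each of the conditions
`A_p`, `A_∞` below. -/
structure IsWeight {n : ℕ} (ω : Rn n → ℝ≥0∞) : Prop where
  aemeasurable : AEMeasurable ω volume
  pos_finite : ∀ᵐ x ∂(volume : Measure (Rn n)), 0 < ω x ∧ ω x < ∞

/-- The measure `ω(x) dx`. -/
def weightMeasure {n : ℕ} (ω : Rn n → ℝ≥0∞) : Measure (Rn n) := volume.withDensity ω

/-- The factor `(1/|B| ∫_B ω^{1-p'})^{1/p'}`, `p' = p/(p-1)`, on the ball `B = B(y,r)`;
for `p = 1` it is understood as `(inf_B ω)⁻¹`, the infimum being the essential one. -/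
def dualAverage {n : ℕ} (p : ℝ) (ω : Rn n → ℝ≥0∞) (y : Rn n) (r : ℝ) : ℝ≥0∞ :=
  if p = 1 then (essInf ω (volume.restrict (ball y r)))⁻¹
  else (⨍⁻ x in ball y r, ω x ^ (1 - p / (p - 1)) ∂volume) ^ (1 / (p / (p - 1)))

/-- The Muckenhoupt class `A_p`, `1 ≤ p < ∞`. -/
def IsAp {n : ℕ} (p : ℝ) (ω : Rn n → ℝ≥0∞) : Prop :=
  IsWeight ω ∧ ∃ C : ℝ≥0, ∀ (y : Rn n) (r : ℝ), 0 < r →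
    (⨍⁻ x in ball y r, ω x ∂volume) ^ (1 / p) * dualAverage p ω y r ≤ C

/-- The class `A_∞`, the union of all `A_p` with `1 ≤ p < ∞`. -/
def IsAInfty {n : ℕ} (ω : Rn n → ℝ≥0∞) : Prop :=
  ∃ p : ℝ, 1 ≤ p ∧ IsAp p ω

/-- The weight `ν_ω = ∏ⱼ ωⱼ^{p/pⱼ}`. -/
def productWeight {n m : ℕ} (p : ℝ) (P : Fin m → ℝ) (ω : Fin m → Rn n → ℝ≥0∞) :
    Rn n → ℝ≥0∞ :=
  fun x => ∏ j, ω j x ^ (p / P j)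

/-- The exponent `p` with `1/p = ∑ⱼ 1/pⱼ`. -/
def jointExponent {m : ℕ} (P : Fin m → ℝ) : ℝ := 1 / ∑ j, 1 / P j

/-- The multiple weight class `A_P`, `P = (p₁,…,p_m)` with `1 ≤ pⱼ < ∞`. -/
def IsMultipleAp {n m : ℕ} (P : Fin m → ℝ) (ω : Fin m → Rn n → ℝ≥0∞) : Prop :=
  (∀ j, IsWeight (ω j)) ∧ ∃ C : ℝ≥0, ∀ (y : Rn n) (r : ℝ), 0 < r →
    (⨍⁻ x in ball y r, productWeight (jointExponent P) P ω x ∂volume) ^ (1 / jointExponent P)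
      * ∏ j, dualAverage (P j) (ω j) y r ≤ C

/-! ### Weighted Lebesgue, weak Lebesgue and amalgam (quasi-)norms -/

variable {𝕜 : Type*} [RCLike 𝕜]

/-- `‖f‖_{L^q(ω)} = (∫ |f|^q ω)^{1/q}`, `0 < q < ∞`. -/
def lebesgueNorm {n : ℕ} (q : ℝ) (ω : Rn n → ℝ≥0∞) (f : Rn n → 𝕜) : ℝ≥0∞ :=
  eLpNorm' f q (weightMeasure ω)

/-- `‖f‖_{L^{q,∞}(ω)} = sup_{t>0} t ω({|f| > t})^{1/q}`, `0 < q < ∞`. -/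
def weakLebesgueNorm {n : ℕ} (q : ℝ) (ω : Rn n → ℝ≥0∞) (f : Rn n → 𝕜) : ℝ≥0∞ :=
  ⨆ t : ℝ≥0, (t : ℝ≥0∞) * weightMeasure ω {x | (t : ℝ≥0∞) < ‖f x‖ₑ} ^ (1 / q)

/-- The amalgam construction over a local (quasi-)norm `N`:
`sup_{r>0} ‖ y ↦ ω(B(y,r))^{1/α-1/q-1/p} N(f χ_{B(y,r)}) ‖_{L^p(dy)}`, where `0 < p ≤ ∞`.
For `p = ∞` one has `1 / p.toReal = 0` and the outer norm is the essential supremum. -/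
def amalgamOf {n : ℕ} (N : (Rn n → 𝕜) → ℝ≥0∞) (q : ℝ) (ω : Rn n → ℝ≥0∞) (p : ℝ≥0∞) (α : ℝ)
    (f : Rn n → 𝕜) : ℝ≥0∞ :=
  ⨆ (r : ℝ) (_ : 0 < r),
    eLpNorm (fun y : Rn n =>
      weightMeasure ω (ball y r) ^ (1 / α - 1 / q - 1 / p.toReal)
        * N ((ball y r).indicator f)) p volume

/-- `‖f‖_{(L^q(ω),L^p)^α}`. -/
def amalgamNorm {n : ℕ} (q : ℝ) (ω : Rn n → ℝ≥0∞) (p : ℝ≥0∞) (α : ℝ) (f : Rn n → 𝕜) : ℝ≥0∞ :=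
  amalgamOf (lebesgueNorm q ω) q ω p α f

/-- `‖f‖_{(L^{q,∞}(ω),L^p)^α}`. -/
def weakAmalgamNorm {n : ℕ} (q : ℝ) (ω : Rn n → ℝ≥0∞) (p : ℝ≥0∞) (α : ℝ) (f : Rn n → 𝕜) :
    ℝ≥0∞ :=
  amalgamOf (weakLebesgueNorm q ω) q ω p α f

/-- The space of the (Lebesgue) measurable functions of finite (quasi-)norm `N`. -/
def spaceOf {n : ℕ} (N : (Rn n → 𝕜) → ℝ≥0∞) : Set (Rn n → 𝕜) :=
  {f | AEStronglyMeasurable f volume ∧ N f < ∞}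

/-! ### Operators -/

/-- `T` is bounded from the product of the spaces with (quasi-)norms `Nⱼ` to the space with
(quasi-)norm `M`. -/
def IsBoundedOperator {n m : ℕ} (N : Fin m → (Rn n → 𝕜) → ℝ≥0∞) (M : (Rn n → 𝕜) → ℝ≥0∞)
    (T : (Fin m → Rn n → 𝕜) → Rn n → 𝕜) : Prop :=
  ∃ C : ℝ≥0, ∀ f : Fin m → Rn n → 𝕜, (∀ j, f j ∈ spaceOf (N j)) →
    T f ∈ spaceOf M ∧ M (T f) ≤ C * ∏ j, N j (f j)

/-- `T` is an `m`-sublinear operator defined on `D₁ × ⋯ × D_m`: it takes values in the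
measurable functions and `|T|` is, almost everywhere, subadditive and absolutely homogeneous in
each variable. -/
structure IsMultisublinearOn {n m : ℕ} (D : Fin m → Set (Rn n → 𝕜))
    (T : (Fin m → Rn n → 𝕜) → Rn n → 𝕜) : Prop where
  aestronglyMeasurable : ∀ f : Fin m → Rn n → 𝕜, (∀ j, f j ∈ D j) →
    AEStronglyMeasurable (T f) volume
  add_le : ∀ f : Fin m → Rn n → 𝕜, (∀ j, f j ∈ D j) → ∀ (i : Fin m), ∀ g ∈ D i, ∀ h ∈ D i,
    ∀ᵐ x ∂(volume : Measure (Rn n)),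
      ‖T (Function.update f i (g + h)) x‖
        ≤ ‖T (Function.update f i g) x‖ + ‖T (Function.update f i h) x‖
  smul_eq : ∀ f : Fin m → Rn n → 𝕜, (∀ j, f j ∈ D j) → ∀ (i : Fin m) (c : 𝕜),
    ∀ᵐ x ∂(volume : Measure (Rn n)),
      ‖T (Function.update f i (c • f i)) x‖ = ‖c‖ * ‖T f x‖

/-- For `B = B(y,r)`, the tuple whose `j`-th entry is `fⱼ χ_{(2B)ᶜ}` for `j ∈ σ` and
`fⱼ χ_{2B}` for `j ∉ σ`. -/
def splitTuple {n m : ℕ} (f : Fin m → Rn n → 𝕜) (σ : Finset (Fin m)) (y : Rn n) (r : ℝ) :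
    Fin m → Rn n → 𝕜 :=
  fun j => if j ∈ σ then ((ball y (2 * r))ᶜ).indicator (f j)
    else (ball y (2 * r)).indicator (f j)

/-- The right-hand side of the off-diagonal condition on `B = B(y,r)` (without its constant):
`∏_{j∉σ} (1/|2B| ∫_{2B} |fⱼ|^s)^{1/s} ·
  ∑_{k≥1} k 2^{-nk|σᶜ|} ∏_{j∈σ} (1/|2^{k+1}B| ∫_{2^{k+1}B \ 2^k B} |fⱼ|^s)^{1/s}`.
The sum may be taken over all `k : ℕ`, since the term `k = 0` vanishes. -/
def offDiagonalBound {n m : ℕ} (s : ℝ) (f : Fin m → Rn n → 𝕜) (σ : Finset (Fin m)) (y : Rn n)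
    (r : ℝ) : ℝ≥0∞ :=
  (∏ j ∈ σᶜ, ((volume (ball y (2 * r)))⁻¹ * ∫⁻ z in ball y (2 * r), ‖f j z‖ₑ ^ s) ^ (1 / s))
    * ∑' k : ℕ, ((k : ℝ≥0∞) / 2 ^ (n * k * σᶜ.card))
      * ∏ j ∈ σ, ((volume (ball y (2 ^ (k + 1) * r)))⁻¹
          * ∫⁻ z in ball y (2 ^ (k + 1) * r) \ ball y (2 ^ k * r), ‖f j z‖ₑ ^ s) ^ (1 / s)

/-- The pointwise off-diagonal condition for an operator `T` defined on `D₁ × ⋯ × D_m`. -/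
def OffDiagonalCondition {n m : ℕ} (s : ℝ) (D : Fin m → Set (Rn n → 𝕜))
    (T : (Fin m → Rn n → 𝕜) → Rn n → 𝕜) : Prop :=
  ∃ C₁ : ℝ≥0, ∀ f : Fin m → Rn n → 𝕜, (∀ j, f j ∈ D j) →
    ∀ σ : Finset (Fin m), σ.Nonempty → ∀ (y : Rn n) (r : ℝ), 0 < r →
      ∀ᵐ x ∂(volume.restrict (ball y r)),
        ‖T (splitTuple f σ y r) x‖ₑ ≤ C₁ * offDiagonalBound s f σ y r

/-- The sums `g + h` with `g ∈ L^q(ω)` and `h ∈ (L^q(ω),L^p)^α`. -/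
def sumSpace {n : ℕ} (𝕜 : Type*) [RCLike 𝕜] (q : ℝ) (ω : Rn n → ℝ≥0∞) (p : ℝ≥0∞) (α : ℝ) :
    Set (Rn n → 𝕜) :=
  {f | ∃ g ∈ spaceOf (lebesgueNorm q ω), ∃ h ∈ spaceOf (amalgamNorm q ω p α), f = g + h}

end WeightedAmalgam

end

/-!
Fix a ball `B` of radius `r`. By sublinearity `|T f|` is at most the sum over all `σ` of the values
of `T` at the tuples which are cut off to `2B` in the variables outside `σ` and to the complement of
`2B` in those of `σ`. For `σ ≠ ∅` the off-diagonal condition bounds the term on `B` by a constant;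
after the factors `2 ^ (-nk)` have been used to enlarge `2B` to `2 ^ (k + 1) B`, this constant is at
most `∑ₖ k ∏ⱼ (mean of |fⱼ|^s over 2 ^ (k + 1) B) ^ (1 / s)` (`offDiagonalBound_le_tsum`,
`exists_enorm_map_le_add_tsum`), and by Hölder's inequality and the condition `A_{Q/s}` the `k`-th
product is at most `C ν(2 ^ (k + 1) B) ^ (-1 / q) ∏ⱼ ‖fⱼ χ_{2 ^ (k + 1) B}‖`
(`exists_prod_setLAverage_rpow_le`). The term with `σ = ∅` is handled by the assumed boundedness on
Lebesgue spaces, and has the same shape with `k = 0`.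

Write `θⱼ = q / Qⱼ`, so that `∑ θⱼ = 1` and `ν = ∏ ωⱼ ^ θⱼ`. The relations between the exponents say
that the amalgam exponents satisfy `δⱼ = θⱼ δ`, where `δ = 1/α - 1/q - 1/p ≤ 0`. Two facts on the
weights are needed:
* `∏ ωⱼ(2B) ^ θⱼ ≤ C ν(B)`. Each `ωⱼ` is of class `A_∞`, so its mean is controlled by its harmonic
  mean of a small order `a`; now Hölder's inequality is applied to
  `ν ^ (-a) = ∏ (ωⱼ ^ (-a)) ^ θⱼ` (`prod_setLAverage_rpow_le`). It allows `ν(B) ^ δ` to be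
  distributed among the factors.
* `ν(B) ≤ ρ ^ k ν(2 ^ k B)` with `ρ < 1`. Together with the converse inequality
  `ν(B) ≤ ∏ ωⱼ(B) ^ θⱼ` (Hölder) the first fact makes `ν` doubling, and a doubling measure on `ℝⁿ`
  is reverse doubling, since `2B \ B` contains a ball comparable with `B`
  (`exists_weightMeasure_geomWeight_ball_le_pow_mul`).

As `δ + 1/q = 1/α - 1/p > 0`, the `k`-th term of the resulting bound carries the geometrically
decaying factor `ρ ^ (k (1/α - 1/p))`, times a product of the functions of `y` whose `L^{pⱼ}` norms
define the amalgam norms of the `fⱼ`. Hölder's inequality in `y` and summation over `k` conclude.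
The exponents `q` and `p` may be smaller than `1`, so that only quasi-triangle inequalities are
available (`IsLocallyQuasiAdditive`, `exists_eLpNorm_tsum_le`). Of the local quasi-norm of the
target nothing else is used, and both parts are instances of `isBoundedOperator_amalgamOf`.
-/

noncomputable section

namespace WeightedAmalgam

/-! ### Powers in `ℝ≥0∞` -/

theorem prod_rpow_const {ι : Type*} {s : Finset ι} (x : ℝ≥0∞) {θ : ι → ℝ}
    (hθ : ∀ j ∈ s, 0 ≤ θ j) : ∏ j ∈ s, x ^ θ j = x ^ ∑ j ∈ s, θ j := by
  classical
  induction s using Finset.induction_on with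
  | empty => simp
  | insert i s hi ih =>
    rw [Finset.prod_insert hi, Finset.sum_insert hi,
      ih fun j hj => hθ j (Finset.mem_insert_of_mem hj),
      ENNReal.rpow_add_of_nonneg _ _ (hθ i (Finset.mem_insert_self i s))
        (Finset.sum_nonneg fun j hj => hθ j (Finset.mem_insert_of_mem hj))]

/-! ### Power means over a probability measure -/

section ProbabilityMeasure

variable {X : Type*} [MeasurableSpace X] {μ : Measure X} [IsProbabilityMeasure μ]

/-- Jensen's inequality for the convex function `t ↦ t ^ (-a)`, in the form in which it follows
from Hölder's inequality. -/
theorem one_le_lintegral_mul_lintegral_rpow_neg {w : X → ℝ≥0∞} (hw : AEMeasurable w μ)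
    (hpos : ∀ᵐ x ∂μ, 0 < w x ∧ w x < ∞) {a : ℝ} (ha : 0 < a) :
    1 ≤ (∫⁻ x, w x ∂μ) * (∫⁻ x, w x ^ (-a) ∂μ) ^ (1 / a) := by
  have h1 : (1 : ℝ≥0∞) ≤ (∫⁻ x, w x ∂μ) ^ (a / (1 + a)) *
      (∫⁻ x, w x ^ (-a) ∂μ) ^ (1 / (1 + a)) := by
    calc (1 : ℝ≥0∞) = ∫⁻ _, 1 ∂μ := by simp
      _ = ∫⁻ x, w x ^ (a / (1 + a)) * (w x ^ (-a)) ^ (1 / (1 + a)) ∂μ := by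
        refine lintegral_congr_ae ?_
        filter_upwards [hpos] with x hx
        rw [← ENNReal.rpow_mul, ← ENNReal.rpow_add _ _ hx.1.ne' hx.2.ne]
        have : a / (1 + a) + -a * (1 / (1 + a)) = 0 := by field_simp; ring
        rw [this, ENNReal.rpow_zero]
      _ ≤ _ := ENNReal.lintegral_mul_norm_pow_le hw (hw.pow_const _) (by positivity)
        (by positivity) (by field_simp; ring)
  have h2 := ENNReal.one_le_rpow h1 (z := (1 + a) / a) (by positivity)
  rw [ENNReal.mul_rpow_of_nonneg _ _ (by positivity), ← ENNReal.rpow_mul,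
    ← ENNReal.rpow_mul] at h2
  convert h2 using 2
  · rw [show a / (1 + a) * ((1 + a) / a) = 1 by field_simp, ENNReal.rpow_one]
  · congr 1; field_simp

/-- Power means over a probability measure increase with the exponent. -/
theorem lintegral_rpow_rpow_inv_mono {u : X → ℝ≥0∞} (hu : AEMeasurable u μ) {a b : ℝ}
    (hb : 0 < b) (hba : b ≤ a) :
    (∫⁻ x, u x ^ b ∂μ) ^ (1 / b) ≤ (∫⁻ x, u x ^ a ∂μ) ^ (1 / a) := by
  have ha : 0 < a := hb.trans_le hba
  have h1 : ∫⁻ x, u x ^ b ∂μ ≤ (∫⁻ x, u x ^ a ∂μ) ^ (b / a) := by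
    have := ENNReal.lintegral_mul_norm_pow_le (μ := μ) (hu.pow_const a)
      (aemeasurable_const (b := (1 : ℝ≥0∞))) (p := b / a) (q := 1 - b / a) (by positivity)
      (by rw [sub_nonneg, div_le_one ha]; exact hba) (by ring)
    simpa [← ENNReal.rpow_mul, mul_div_cancel₀ b ha.ne'] using this
  calc (∫⁻ x, u x ^ b ∂μ) ^ (1 / b) ≤ ((∫⁻ x, u x ^ a ∂μ) ^ (b / a)) ^ (1 / b) := by
        gcongr
    _ = _ := by rw [← ENNReal.rpow_mul]; congr 1; field_simp

end ProbabilityMeasure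

/-! ### Averages over balls -/

section Balls

variable {n : ℕ}

theorem setLAverage_eq_lintegral_cond (F : Rn n → ℝ≥0∞) (s : Set (Rn n)) :
    ⨍⁻ x in s, F x ∂volume = ∫⁻ x, F x ∂(ProbabilityTheory.cond volume s) := by
  simp [laverage, ProbabilityTheory.cond]

theorem volume_ball_ne_zero (y : Rn n) {r : ℝ} (hr : 0 < r) : volume (ball y r) ≠ 0 :=
  (measure_ball_pos _ _ hr).ne'

theorem volume_ball_ne_top (y : Rn n) (r : ℝ) : volume (ball y r) ≠ ∞ := measure_ball_lt_top.ne

theorem isProbabilityMeasure_cond_ball (y : Rn n) {r : ℝ} (hr : 0 < r) :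
    IsProbabilityMeasure (ProbabilityTheory.cond volume (ball y r)) :=
  ProbabilityTheory.cond_isProbabilityMeasure_of_finite (volume_ball_ne_zero y hr)
    (volume_ball_ne_top y r)

theorem volume_ball_mul (y y' : Rn n) {c : ℝ} (hc : 0 < c) (r : ℝ) :
    volume (ball y (c * r)) = ENNReal.ofReal (c ^ n) * volume (ball y' r) := by
  rw [Measure.addHaar_ball_mul_of_pos _ _ hc, Measure.addHaar_ball_center, finrank_euclideanSpace,
    Fintype.card_fin, Measure.addHaar_ball_center volume y']

theorem setLIntegral_eq_volume_mul_setLAverage (F : Rn n → ℝ≥0∞) (y : Rn n) {r : ℝ}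
    (hr : 0 < r) :
    ∫⁻ x in ball y r, F x = volume (ball y r) * ⨍⁻ x in ball y r, F x ∂volume := by
  rw [setLAverage_eq, ENNReal.mul_div_cancel (volume_ball_ne_zero y hr) (volume_ball_ne_top y r)]

theorem setLAverage_le_of_ball_subset (F : Rn n → ℝ≥0∞) {y y' : Rn n} {c r : ℝ} (hc : 0 < c)
    (h : ball y' r ⊆ ball y (c * r)) :
    ⨍⁻ x in ball y' r, F x ∂volume ≤
      ENNReal.ofReal (c ^ n) * ⨍⁻ x in ball y (c * r), F x ∂volume := by
  have hv := volume_ball_mul y y' hc r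
  have hc0 : ENNReal.ofReal (c ^ n) ≠ 0 := by simpa using pow_pos hc n
  rw [setLAverage_eq, setLAverage_eq, hv, ← mul_div_assoc,
    ENNReal.mul_div_mul_left _ _ hc0 ENNReal.ofReal_ne_top]
  gcongr

end Balls

/-! ### Weights of class `A_∞` -/

section Weights

variable {n : ℕ}

/-- Bound of the mean of `ω` by its harmonic-type mean of order `-a`, uniformly over balls.
Every weight of class `A_∞` satisfies it for small `a > 0`. -/
def HasHarmonicBound (a : ℝ) (C : ℝ≥0) (ω : Rn n → ℝ≥0∞) : Prop :=
  ∀ (y : Rn n) (r : ℝ), 0 < r →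
    (⨍⁻ x in ball y r, ω x ∂volume) * (⨍⁻ x in ball y r, ω x ^ (-a) ∂volume) ^ (1 / a) ≤ C

theorem ae_cond_ball {P : Rn n → Prop} (h : ∀ᵐ x, P x) (y : Rn n) (r : ℝ) :
    ∀ᵐ x ∂(ProbabilityTheory.cond volume (ball y r)), P x :=
  ProbabilityTheory.cond_absolutelyContinuous.ae_le h

theorem aemeasurable_cond_ball {w : Rn n → ℝ≥0∞} (h : AEMeasurable w volume) (y : Rn n) (r : ℝ) :
    AEMeasurable w (ProbabilityTheory.cond volume (ball y r)) :=
  h.mono_ac ProbabilityTheory.cond_absolutelyContinuous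

theorem HasHarmonicBound.of_le {a b : ℝ} {C : ℝ≥0} {ω : Rn n → ℝ≥0∞} (hω : AEMeasurable ω volume)
    (hb : 0 < b) (hba : b ≤ a) (h : HasHarmonicBound a C ω) : HasHarmonicBound b C ω := by
  intro y r hr
  refine le_trans ?_ (h y r hr)
  gcongr 1
  have := isProbabilityMeasure_cond_ball y hr
  simp only [setLAverage_eq_lintegral_cond]
  have := lintegral_rpow_rpow_inv_mono ((aemeasurable_cond_ball hω y r).inv) hb hba
  simpa [ENNReal.inv_rpow, ENNReal.rpow_neg] using this

theorem IsAp.exists_hasHarmonicBound {p : ℝ} (hp : 1 ≤ p) {ω : Rn n → ℝ≥0∞} (h : IsAp p ω) :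
    ∃ a > 0, ∃ C : ℝ≥0, HasHarmonicBound a C ω := by
  obtain ⟨hw, C, hC⟩ := h
  rcases hp.eq_or_lt with rfl | hp
  · refine ⟨1, one_pos, C, fun y r hr => le_trans ?_ (hC y r hr)⟩
    have := isProbabilityMeasure_cond_ball y hr
    simp only [dualAverage, if_true, div_one, ENNReal.rpow_one]
    gcongr
    calc ⨍⁻ x in ball y r, ω x ^ (-1 : ℝ) ∂volume
        ≤ ⨍⁻ x in ball y r, (essInf ω (volume.restrict (ball y r)))⁻¹ ∂volume := by
          refine lintegral_mono_ae (Measure.ae_smul_measure ?_ _)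
          filter_upwards [ae_essInf_le (f := ω) (μ := volume.restrict (ball y r))] with x hx
          rw [ENNReal.rpow_neg_one]
          exact ENNReal.inv_le_inv.2 hx
      _ = _ := by rw [setLAverage_eq_lintegral_cond]; simp
  · have hp' : 0 < p - 1 := by linarith
    have hp0 : 0 < p := by linarith
    refine ⟨1 / (p - 1), by positivity, C ^ p, fun y r hr => ?_⟩
    have := ENNReal.rpow_le_rpow (hC y r hr) hp0.le
    rw [dualAverage, if_neg hp.ne', ENNReal.mul_rpow_of_nonneg _ _ hp0.le, ← ENNReal.rpow_mul,
      ← ENNReal.rpow_mul] at this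
    rw [ENNReal.coe_rpow_of_nonneg _ hp0.le]
    convert this using 2
    · rw [one_div_mul_cancel hp0.ne', ENNReal.rpow_one]
    · congr 1
      · refine lintegral_congr fun x => ?_
        congr 1; field_simp; ring
      · field_simp

/-- Finitely many weights of class `A_∞` share the order and the constant of the bound. -/
theorem exists_common_hasHarmonicBound {m : ℕ} {ω : Fin m → Rn n → ℝ≥0∞}
    (hω : ∀ j, IsAInfty (ω j)) : ∃ a > 0, ∃ C : ℝ≥0, ∀ j, HasHarmonicBound a C (ω j) := by
  have h : ∀ j, ∃ a > 0, ∃ C : ℝ≥0, HasHarmonicBound a C (ω j) := fun j => by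
    obtain ⟨p, hp, h⟩ := hω j
    exact h.exists_hasHarmonicBound hp
  choose a ha C hC using h
  have ham : ∀ j, AEMeasurable (ω j) volume := fun j => (hω j).choose_spec.2.1.aemeasurable
  obtain ⟨b, hb, hba⟩ : ∃ b > 0, ∀ j, b ≤ a j := by
    rcases isEmpty_or_nonempty (Fin m) with hm | hm
    · exact ⟨1, one_pos, fun j => hm.elim j⟩
    · obtain ⟨i, hi⟩ := Finite.exists_min a
      exact ⟨a i, ha i, hi⟩
  refine ⟨b, hb, ∑ j, C j, fun j y r hr => ((hC j).of_le (ham j) hb (hba j) y r hr).trans ?_⟩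
  exact_mod_cast Finset.single_le_sum (f := C) (fun _ _ => zero_le) (Finset.mem_univ j)

theorem IsWeight.setLAverage_ne_zero {ω : Rn n → ℝ≥0∞} (hω : IsWeight ω) (y : Rn n) {r : ℝ}
    (hr : 0 < r) : ⨍⁻ x in ball y r, ω x ∂volume ≠ 0 := by
  have := isProbabilityMeasure_cond_ball y hr
  rw [setLAverage_eq_lintegral_cond]
  intro h0
  rw [lintegral_eq_zero_iff' (aemeasurable_cond_ball hω.aemeasurable y r)] at h0
  have : ∀ᵐ x ∂(ProbabilityTheory.cond volume (ball y r)), False := by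
    filter_upwards [h0, ae_cond_ball hω.pos_finite y r] with x hx hx'
    exact hx'.1.ne' hx
  exact this.exists.elim fun _ => id

theorem IsWeight.rpow {ω : Rn n → ℝ≥0∞} (hω : IsWeight ω) (a : ℝ) :
    IsWeight (fun x => ω x ^ a) := by
  refine ⟨hω.aemeasurable.pow_const _, ?_⟩
  filter_upwards [hω.pos_finite] with x hx
  exact ⟨ENNReal.rpow_pos hx.1 hx.2.ne, (ENNReal.rpow_ne_top_of_ne_zero hx.1.ne' hx.2.ne).lt_top⟩

theorem HasHarmonicBound.setLAverage_ne_top {a : ℝ} {C : ℝ≥0} {ω : Rn n → ℝ≥0∞} (ha : 0 < a)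
    (hω : IsWeight ω) (h : HasHarmonicBound a C ω) (y : Rn n) {r : ℝ} (hr : 0 < r) :
    ⨍⁻ x in ball y r, ω x ∂volume ≠ ∞ := by
  intro ht
  have h1 := h y r hr
  rw [ht, ENNReal.top_mul] at h1
  · simp at h1
  · have := (hω.rpow (-a)).setLAverage_ne_zero y hr
    simp [ENNReal.rpow_eq_zero_iff, this, ha.le]

end Weights

/-! ### The product weight -/

section ProductWeight

variable {n m : ℕ}

/-- The geometric mean `∏ⱼ ωⱼ ^ θⱼ`, the form in which the product weight is used. -/
def geomWeight (θ : Fin m → ℝ) (ω : Fin m → Rn n → ℝ≥0∞) : Rn n → ℝ≥0∞ :=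
  fun x => ∏ j, ω j x ^ θ j

theorem isWeight_geomWeight {θ : Fin m → ℝ} {ω : Fin m → Rn n → ℝ≥0∞} (hω : ∀ j, IsWeight (ω j)) :
    IsWeight (geomWeight θ ω) := by
  refine ⟨Finset.aemeasurable_fun_prod _ fun j _ => (hω j).aemeasurable.pow_const _, ?_⟩
  have := ae_all_iff.2 fun j => ((hω j).rpow (θ j)).pos_finite
  filter_upwards [this] with x hx
  refine ⟨?_, ENNReal.prod_lt_top fun j _ => (hx j).2⟩
  rw [pos_iff_ne_zero]
  exact Finset.prod_ne_zero_iff.2 fun j _ => (hx j).1.ne'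

theorem setLAverage_geomWeight_le {θ : Fin m → ℝ} (hθ : ∀ j, 0 ≤ θ j) (hθ1 : ∑ j, θ j = 1)
    {ω : Fin m → Rn n → ℝ≥0∞} (hω : ∀ j, IsWeight (ω j)) (y : Rn n) (r : ℝ) :
    ⨍⁻ x in ball y r, geomWeight θ ω x ∂volume ≤
      ∏ j, (⨍⁻ x in ball y r, ω j x ∂volume) ^ θ j := by
  simp only [setLAverage_eq_lintegral_cond]
  exact ENNReal.lintegral_prod_norm_pow_le _
    (fun j _ => aemeasurable_cond_ball (hω j).aemeasurable y r) hθ1 fun j _ => hθ j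

/-- For weights of class `A_∞` Hölder's inequality `setLAverage_geomWeight_le` can be reversed,
even with a smaller ball on the other side: Hölder's inequality is applied to
`ν ^ (-a) = ∏ⱼ (ωⱼ ^ (-a)) ^ θⱼ` on the large ball and Jensen's inequality on the small one. -/
theorem prod_setLAverage_rpow_le {θ : Fin m → ℝ} (hθ : ∀ j, 0 ≤ θ j) (hθ1 : ∑ j, θ j = 1)
    {ω : Fin m → Rn n → ℝ≥0∞} (hω : ∀ j, IsWeight (ω j)) {a : ℝ} (ha : 0 < a) {C : ℝ≥0}
    (hC : ∀ j, HasHarmonicBound a C (ω j)) {y y' : Rn n} {c r : ℝ} (hc : 0 < c)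
    (hr : 0 < r) (h : ball y' r ⊆ ball y (c * r)) :
    ∏ j, (⨍⁻ x in ball y (c * r), ω j x ∂volume) ^ θ j ≤
      C * ENNReal.ofReal (c ^ n) ^ (1 / a) * ⨍⁻ x in ball y' r, geomWeight θ ω x ∂volume := by
  have hcr : 0 < c * r := by positivity
  have hν : IsWeight (geomWeight θ ω) := isWeight_geomWeight hω
  set S : ℝ≥0∞ := ∏ j, (⨍⁻ x in ball y (c * r), ω j x ^ (-a) ∂volume) ^ θ j with hS
  have hH : ⨍⁻ x in ball y (c * r), geomWeight θ ω x ^ (-a) ∂volume ≤ S := by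
    have h1 := setLAverage_geomWeight_le hθ hθ1 (fun j => (hω j).rpow (-a)) y (c * r)
    refine le_trans (le_of_eq ?_) h1
    simp only [setLAverage_eq_lintegral_cond]
    refine lintegral_congr_ae ?_
    filter_upwards [ae_cond_ball (ae_all_iff.2 fun j => (hω j).pos_finite) y (c * r)] with x hx
    simp only [geomWeight]
    rw [← ENNReal.prod_rpow_of_ne_top]
    · refine Finset.prod_congr rfl fun j _ => ?_
      rw [← ENNReal.rpow_mul, ← ENNReal.rpow_mul, mul_comm]
    · exact fun j _ => ENNReal.rpow_ne_top_of_ne_zero (hx j).1.ne' (hx j).2.ne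
  have hJ : 1 ≤ (⨍⁻ x in ball y' r, geomWeight θ ω x ∂volume) *
      (ENNReal.ofReal (c ^ n) * S) ^ (1 / a) := by
    have hp := isProbabilityMeasure_cond_ball y' hr
    have h1 := one_le_lintegral_mul_lintegral_rpow_neg
      (aemeasurable_cond_ball hν.aemeasurable y' r) (ae_cond_ball hν.pos_finite y' r) ha
    rw [← setLAverage_eq_lintegral_cond, ← setLAverage_eq_lintegral_cond] at h1
    refine h1.trans ?_
    gcongr
    exact (setLAverage_le_of_ball_subset _ hc h).trans (by gcongr)
  have hP : (∏ j, (⨍⁻ x in ball y (c * r), ω j x ∂volume) ^ θ j) * S ^ (1 / a) ≤ C := by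
    rw [hS, ← ENNReal.prod_rpow_of_nonneg (by positivity), ← Finset.prod_mul_distrib]
    calc _ = ∏ j, ((⨍⁻ x in ball y (c * r), ω j x ∂volume) *
            (⨍⁻ x in ball y (c * r), ω j x ^ (-a) ∂volume) ^ (1 / a)) ^ θ j := by
          refine Finset.prod_congr rfl fun j _ => ?_
          rw [ENNReal.mul_rpow_of_nonneg _ _ (hθ j), ← ENNReal.rpow_mul, ← ENNReal.rpow_mul,
            mul_comm (θ j)]
      _ ≤ ∏ j, (C : ℝ≥0∞) ^ θ j := by
          refine Finset.prod_le_prod' fun j _ => ?_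
          exact ENNReal.rpow_le_rpow (hC j y _ hcr) (hθ j)
      _ = C := by
          rw [prod_rpow_const _ fun j _ => hθ j, hθ1, ENNReal.rpow_one]
  calc ∏ j, (⨍⁻ x in ball y (c * r), ω j x ∂volume) ^ θ j
      ≤ (∏ j, (⨍⁻ x in ball y (c * r), ω j x ∂volume) ^ θ j) *
        ((⨍⁻ x in ball y' r, geomWeight θ ω x ∂volume) *
          (ENNReal.ofReal (c ^ n) * S) ^ (1 / a)) := le_mul_of_one_le_right' hJ
    _ = ((∏ j, (⨍⁻ x in ball y (c * r), ω j x ∂volume) ^ θ j) * S ^ (1 / a)) *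
        ENNReal.ofReal (c ^ n) ^ (1 / a) *
          (⨍⁻ x in ball y' r, geomWeight θ ω x ∂volume) := by
        rw [ENNReal.mul_rpow_of_nonneg _ _ (by positivity)]; ring
    _ ≤ _ := by gcongr

end ProductWeight

/-! ### Weighted measures of balls -/

section BallMeasures

variable {n m : ℕ}

theorem weightMeasure_ball (ω : Rn n → ℝ≥0∞) (y : Rn n) {r : ℝ} (hr : 0 < r) :
    weightMeasure ω (ball y r) = volume (ball y r) * ⨍⁻ x in ball y r, ω x ∂volume := by
  rw [weightMeasure, withDensity_apply _ measurableSet_ball,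
    setLIntegral_eq_volume_mul_setLAverage _ _ hr]

instance (ω : Rn n → ℝ≥0∞) : SFinite (weightMeasure ω) :=
  Measure.withDensity.instSFinite

theorem weightMeasure_absolutelyContinuous (ω : Rn n → ℝ≥0∞) : weightMeasure ω ≪ volume :=
  withDensity_absolutelyContinuous _ _

theorem IsWeight.weightMeasure_ball_ne_zero {ω : Rn n → ℝ≥0∞} (hω : IsWeight ω) (y : Rn n)
    {r : ℝ} (hr : 0 < r) : weightMeasure ω (ball y r) ≠ 0 := by
  rw [weightMeasure_ball ω y hr]
  exact mul_ne_zero (volume_ball_ne_zero y hr) (hω.setLAverage_ne_zero y hr)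

theorem IsAInfty.isWeight {ω : Rn n → ℝ≥0∞} (hω : IsAInfty ω) : IsWeight ω := by
  obtain ⟨_, _, h⟩ := hω
  exact h.1

theorem IsAInfty.weightMeasure_ball_ne_top {ω : Rn n → ℝ≥0∞} (hω : IsAInfty ω) (y : Rn n)
    (r : ℝ) : weightMeasure ω (ball y r) ≠ ∞ := by
  rcases le_or_gt r 0 with hr | hr
  · simp [ball_eq_empty.2 hr]
  obtain ⟨p, hp, h⟩ := hω
  obtain ⟨a, ha, C, hC⟩ := h.exists_hasHarmonicBound hp
  rw [weightMeasure_ball ω y hr]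
  exact ENNReal.mul_ne_top (volume_ball_ne_top y r) (hC.setLAverage_ne_top ha h.1 y hr)

theorem prod_weightMeasure_ball_rpow {θ : Fin m → ℝ} (hθ : ∀ j, 0 ≤ θ j) (hθ1 : ∑ j, θ j = 1)
    (ω : Fin m → Rn n → ℝ≥0∞) (y : Rn n) {r : ℝ} (hr : 0 < r) :
    ∏ j, weightMeasure (ω j) (ball y r) ^ θ j =
      volume (ball y r) * ∏ j, (⨍⁻ x in ball y r, ω j x ∂volume) ^ θ j := by
  simp_rw [weightMeasure_ball _ y hr, ENNReal.mul_rpow_of_nonneg _ _ (hθ _)]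
  rw [Finset.prod_mul_distrib, prod_rpow_const _ fun j _ => hθ j, hθ1, ENNReal.rpow_one]

theorem weightMeasure_geomWeight_ball_le {θ : Fin m → ℝ} (hθ : ∀ j, 0 ≤ θ j)
    (hθ1 : ∑ j, θ j = 1) {ω : Fin m → Rn n → ℝ≥0∞} (hω : ∀ j, IsWeight (ω j)) (y : Rn n)
    {r : ℝ} (hr : 0 < r) :
    weightMeasure (geomWeight θ ω) (ball y r) ≤ ∏ j, weightMeasure (ω j) (ball y r) ^ θ j := by
  rw [prod_weightMeasure_ball_rpow hθ hθ1 ω y hr, weightMeasure_ball _ y hr]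
  gcongr
  exact setLAverage_geomWeight_le hθ hθ1 hω y r

/-- The measures `ωⱼ dx` of a ball are controlled by the measure `ν dx` of any ball of
comparable size which it contains. -/
theorem exists_prod_weightMeasure_ball_rpow_le {θ : Fin m → ℝ} (hθ : ∀ j, 0 ≤ θ j)
    (hθ1 : ∑ j, θ j = 1) {ω : Fin m → Rn n → ℝ≥0∞} (hω : ∀ j, IsAInfty (ω j)) :
    ∃ C : ℝ≥0, ∀ (y y' : Rn n) (r : ℝ), 0 < r → ball y' r ⊆ ball y (4 * r) →
      ∏ j, weightMeasure (ω j) (ball y (4 * r)) ^ θ j ≤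
        C * weightMeasure (geomWeight θ ω) (ball y' r) := by
  obtain ⟨a, ha, C, hC⟩ := exists_common_hasHarmonicBound hω
  refine ⟨(C * ENNReal.ofReal (4 ^ n) ^ (1 / a) * ENNReal.ofReal (4 ^ n)).toNNReal,
    fun y y' r hr h => ?_⟩
  rw [ENNReal.coe_toNNReal, prod_weightMeasure_ball_rpow hθ hθ1 ω y (by positivity),
    weightMeasure_ball _ y' hr, volume_ball_mul y y' (by norm_num : (0 : ℝ) < 4)]
  · calc _ ≤ ENNReal.ofReal (4 ^ n) * volume (ball y' r) *
          (C * ENNReal.ofReal (4 ^ n) ^ (1 / a) *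
            ⨍⁻ x in ball y' r, geomWeight θ ω x ∂volume) := by
          gcongr
          exact prod_setLAverage_rpow_le hθ hθ1 (fun j => (hω j).isWeight) ha hC (by norm_num) hr h
      _ = _ := by ring
  · exact ENNReal.mul_ne_top (ENNReal.mul_ne_top ENNReal.coe_ne_top
      (ENNReal.rpow_ne_top_of_nonneg (by positivity) ENNReal.ofReal_ne_top)) ENNReal.ofReal_ne_top

theorem exists_prod_weightMeasure_double_ball_rpow_le {θ : Fin m → ℝ} (hθ : ∀ j, 0 ≤ θ j)
    (hθ1 : ∑ j, θ j = 1) {ω : Fin m → Rn n → ℝ≥0∞} (hω : ∀ j, IsAInfty (ω j)) :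
    ∃ C : ℝ≥0, ∀ (y : Rn n) (r : ℝ), 0 < r →
      ∏ j, weightMeasure (ω j) (ball y (2 * r)) ^ θ j ≤
        C * weightMeasure (geomWeight θ ω) (ball y r) := by
  obtain ⟨C, hC⟩ := exists_prod_weightMeasure_ball_rpow_le hθ hθ1 hω
  refine ⟨C, fun y r hr => le_trans ?_ (hC y y r hr (ball_subset_ball (by linarith)))⟩
  refine Finset.prod_le_prod' fun j _ => ENNReal.rpow_le_rpow ?_ (hθ j)
  exact measure_mono (ball_subset_ball (by linarith))

/-- Reverse doubling of the product weight: the annulus `2B \ B` contains a ball of half the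
radius, whose measure is comparable with that of `2B`. -/
theorem exists_weightMeasure_geomWeight_ball_le_mul_double (hn : 1 ≤ n) {θ : Fin m → ℝ}
    (hθ : ∀ j, 0 ≤ θ j) (hθ1 : ∑ j, θ j = 1) {ω : Fin m → Rn n → ℝ≥0∞}
    (hω : ∀ j, IsAInfty (ω j)) :
    ∃ ρ : ℝ≥0, ρ < 1 ∧ ∀ (y : Rn n) (r : ℝ), 0 < r →
      weightMeasure (geomWeight θ ω) (ball y r) ≤
        ρ * weightMeasure (geomWeight θ ω) (ball y (2 * r)) := by
  obtain ⟨C, hC⟩ := exists_prod_weightMeasure_ball_rpow_le hθ hθ1 hω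
  refine ⟨C / (1 + C), by rw [div_lt_one (by positivity)]; exact lt_one_add C,
    fun y r hr => ?_⟩
  set ν := weightMeasure (geomWeight θ ω) with hν
  let e : Rn n := EuclideanSpace.single ⟨0, hn⟩ (3 * (r / 2))
  have he : ‖e‖ = 3 * (r / 2) := by
    simp only [e, PiLp.norm_single, Real.norm_eq_abs]
    exact abs_of_pos (by positivity)
  have hsub : ball (y + e) (r / 2) ⊆ ball y (4 * (r / 2)) := by
    refine ball_subset_ball' ?_
    rw [dist_self_add_left, he]; linarith
  have hdisj : Disjoint (ball y r) (ball (y + e) (r / 2)) := by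
    refine ball_disjoint_ball ?_
    rw [dist_self_add_right, he]; linarith
  have h1 : ν (ball y (2 * r)) ≤ C * ν (ball (y + e) (r / 2)) := by
    have h2 := hC y (y + e) (r / 2) (by positivity) hsub
    rw [show 2 * r = 4 * (r / 2) by ring]
    exact (weightMeasure_geomWeight_ball_le hθ hθ1 (fun j => (hω j).isWeight) y
      (by positivity)).trans h2
  have h2 : ν (ball y r) + ν (ball (y + e) (r / 2)) ≤ ν (ball y (2 * r)) := by
    rw [← measure_union hdisj measurableSet_ball]
    refine measure_mono (Set.union_subset (ball_subset_ball (by linarith)) (hsub.trans ?_))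
    exact ball_subset_ball (by linarith)
  have h3 : (1 + C) * ν (ball y r) ≤ C * ν (ball y (2 * r)) := by
    calc (1 + C) * ν (ball y r) = ν (ball y r) + C * ν (ball y r) := by ring
      _ ≤ C * ν (ball (y + e) (r / 2)) + C * ν (ball y r) := by
        gcongr
        exact (measure_mono (ball_subset_ball (by linarith))).trans h1
      _ = C * (ν (ball y r) + ν (ball (y + e) (r / 2))) := by ring
      _ ≤ _ := by gcongr
  rw [ENNReal.coe_div (by positivity), ENNReal.coe_add, ENNReal.coe_one, div_eq_mul_inv,
    mul_assoc, mul_comm (_⁻¹), ← mul_assoc, ← div_eq_mul_inv, ENNReal.le_div_iff_mul_le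
    (by simp) (by simp), mul_comm]
  exact h3

theorem exists_weightMeasure_geomWeight_ball_le_pow_mul (hn : 1 ≤ n) {θ : Fin m → ℝ}
    (hθ : ∀ j, 0 ≤ θ j) (hθ1 : ∑ j, θ j = 1) {ω : Fin m → Rn n → ℝ≥0∞}
    (hω : ∀ j, IsAInfty (ω j)) :
    ∃ ρ : ℝ≥0, ρ < 1 ∧ ∀ (k : ℕ) (y : Rn n) (r : ℝ), 0 < r →
      weightMeasure (geomWeight θ ω) (ball y r) ≤
        ρ ^ k * weightMeasure (geomWeight θ ω) (ball y (2 ^ k * r)) := by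
  obtain ⟨ρ, hρ, h⟩ := exists_weightMeasure_geomWeight_ball_le_mul_double hn hθ hθ1 hω
  refine ⟨ρ, hρ, fun k => ?_⟩
  induction k with
  | zero => simp
  | succ k ih =>
    intro y r hr
    refine (ih y r hr).trans ?_
    rw [pow_succ, pow_succ, mul_assoc, mul_comm (2 ^ k) (2 : ℝ), mul_assoc]
    gcongr
    exact h y _ (by positivity)

/-- The measure of a ball depends measurably on its centre. -/
theorem measurable_measure_ball {μ : Measure (Rn n)} [SFinite μ] (r : ℝ) :
    Measurable fun y => μ (ball y r) := by
  have : MeasurableSet {z : Rn n × Rn n | dist z.2 z.1 < r} :=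
    measurableSet_lt (by fun_prop) measurable_const
  exact measurable_measure_prodMk_left this

end BallMeasures

/-! ### Local norms -/

section LocalNorms

variable {n m : ℕ} {𝕜 : Type*} [RCLike 𝕜]

theorem lintegral_weightMeasure {ω : Rn n → ℝ≥0∞} (hω : IsWeight ω) {F : Rn n → ℝ≥0∞}
    (hF : AEMeasurable F volume) : ∫⁻ x, F x ∂(weightMeasure ω) = ∫⁻ x, ω x * F x := by
  rw [weightMeasure, lintegral_withDensity_eq_lintegral_mul₀ hω.aemeasurable hF]; rfl

theorem lebesgueNorm_indicator_ball_eq_lintegral {q : ℝ} (hq : 0 < q) (ω : Rn n → ℝ≥0∞)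
    (f : Rn n → 𝕜) (y : Rn n) (r : ℝ) :
    lebesgueNorm q ω ((ball y r).indicator f) =
      (∫⁻ x in ball y r, ‖f x‖ₑ ^ q ∂(weightMeasure ω)) ^ (1 / q) := by
  rw [lebesgueNorm, eLpNorm'_eq_lintegral_enorm, ← lintegral_indicator measurableSet_ball]
  congr 1
  refine lintegral_congr fun x => ?_
  by_cases hx : x ∈ ball y r <;> simp [hx, hq]

theorem measurable_lebesgueNorm_indicator_ball {q : ℝ} (hq : 0 < q) (ω : Rn n → ℝ≥0∞)
    (f : Rn n → 𝕜) (r : ℝ) :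
    Measurable fun y => lebesgueNorm q ω ((ball y r).indicator f) := by
  simp_rw [lebesgueNorm_indicator_ball_eq_lintegral hq]
  refine Measurable.pow_const ?_ _
  have h := measurable_measure_ball
    (μ := (weightMeasure ω).withDensity fun x => ‖f x‖ₑ ^ q) r
  simpa only [withDensity_apply _ measurableSet_ball] using h

theorem lebesgueNorm_mono {q : ℝ} (hq : 0 < q) (ω : Rn n → ℝ≥0∞) {f g : Rn n → 𝕜}
    (h : ∀ x, ‖f x‖ₑ ≤ ‖g x‖ₑ) : lebesgueNorm q ω f ≤ lebesgueNorm q ω g := by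
  simp only [lebesgueNorm, eLpNorm'_eq_lintegral_enorm]
  gcongr with x
  exact h x

/-- Hölder's inequality with the weight inserted, in the normalization of the `A_p` condition. -/
theorem setLAverage_le_mul_dualAverage {P : ℝ} (hP : 1 ≤ P) {ω : Rn n → ℝ≥0∞}
    (hω : IsWeight ω) {F : Rn n → ℝ≥0∞} (hF : AEMeasurable F volume) (y : Rn n) (r : ℝ) :
    (volume (ball y r))⁻¹ * ∫⁻ x in ball y r, F x ≤
      ((volume (ball y r))⁻¹ * ∫⁻ x in ball y r, ω x * F x ^ P) ^ (1 / P) *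
        dualAverage P ω y r := by
  rcases hP.eq_or_lt with rfl | hP
  · simp only [dualAverage, if_true, div_one, ENNReal.rpow_one]
    rw [mul_assoc, ← lintegral_mul_const'' _ (by
      exact (hω.aemeasurable.mul hF).restrict)]
    refine mul_le_mul_right ?_ _
    refine lintegral_mono_ae ?_
    filter_upwards [ae_essInf_le (f := ω) (μ := volume.restrict (ball y r)),
      ae_restrict_of_ae hω.pos_finite] with x hx hx'
    calc F x = ω x * F x * (ω x)⁻¹ := by
          rw [mul_right_comm, ENNReal.mul_inv_cancel hx'.1.ne' hx'.2.ne, one_mul]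
      _ ≤ _ := by gcongr
  · have hP0 : 0 < P := by linarith
    have hP1 : 0 < P - 1 := by linarith
    rw [dualAverage, if_neg hP.ne']
    have e (G : Rn n → ℝ≥0∞) : (volume (ball y r))⁻¹ * ∫⁻ x in ball y r, G x =
        ∫⁻ x, G x ∂(ProbabilityTheory.cond volume (ball y r)) := by
      rw [← setLAverage_eq_lintegral_cond, setLAverage_eq, mul_comm, div_eq_mul_inv]
    rw [e, e, setLAverage_eq_lintegral_cond]
    have hωB := aemeasurable_cond_ball hω.aemeasurable y r
    have hFB := aemeasurable_cond_ball hF y r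
    refine le_trans (le_of_eq ?_) (ENNReal.lintegral_mul_norm_pow_le
      (hωB.mul (hFB.pow_const P)) (hωB.pow_const (1 - P / (P - 1)))
      (by positivity) (by positivity) (by field_simp; ring))
    refine lintegral_congr_ae ?_
    filter_upwards [ae_cond_ball hω.pos_finite y r] with x hx
    rw [Pi.mul_apply, ENNReal.mul_rpow_of_nonneg _ _ (by positivity), ← ENNReal.rpow_mul,
      ← ENNReal.rpow_mul, mul_right_comm, ← ENNReal.rpow_add _ _ hx.1.ne' hx.2.ne]
    have h1 : 1 / P + (1 - P / (P - 1)) * (1 / (P / (P - 1))) = 0 := by field_simp; ring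
    rw [h1, ENNReal.rpow_zero, mul_one_div_cancel hP0.ne', ENNReal.rpow_one, one_mul]

theorem setLAverage_rpow_le_lebesgueNorm {s Q : ℝ} (hs : 1 ≤ s) (hsQ : s ≤ Q)
    {ω : Rn n → ℝ≥0∞} (hω : IsWeight ω) {f : Rn n → 𝕜} (hf : AEStronglyMeasurable f volume)
    (y : Rn n) (r : ℝ) :
    ((volume (ball y r))⁻¹ * ∫⁻ x in ball y r, ‖f x‖ₑ ^ s) ^ (1 / s) ≤
      volume (ball y r) ^ (-(1 / Q)) * lebesgueNorm Q ω ((ball y r).indicator f) *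
        dualAverage (Q / s) ω y r ^ (1 / s) := by
  have hs0 : 0 < s := by linarith
  have hQ0 : 0 < Q := by linarith
  have hm : AEMeasurable (fun x => ‖f x‖ₑ) volume := hf.enorm
  have h := ENNReal.rpow_le_rpow (setLAverage_le_mul_dualAverage (P := Q / s)
    (by rwa [one_le_div hs0]) hω (hm.pow_const s) y r) (z := 1 / s) (by positivity)
  refine h.trans (le_of_eq ?_)
  rw [ENNReal.mul_rpow_of_nonneg _ _ (by positivity), ← ENNReal.rpow_mul,
    show 1 / (Q / s) * (1 / s) = 1 / Q by field_simp,
    ENNReal.mul_rpow_of_nonneg _ _ (by positivity), ENNReal.inv_rpow, ← ENNReal.rpow_neg,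
    lebesgueNorm_indicator_ball_eq_lintegral hQ0]
  congr 3
  rw [← lintegral_indicator measurableSet_ball, ← lintegral_indicator measurableSet_ball,
    lintegral_weightMeasure hω]
  · refine lintegral_congr fun x => ?_
    by_cases hx : x ∈ ball y r
    · simp only [hx, Set.indicator_of_mem]
      rw [← ENNReal.rpow_mul, mul_div_cancel₀ Q hs0.ne']
    · simp [hx]
  · exact (hm.pow_const Q).indicator measurableSet_ball

/-- The role of the condition `A_{Q/s}`: the product of the means of `|fⱼ|^s` over a ball `B` is
bounded by `ν(B)^{-1/q}` times the product of the weighted norms on `B`. -/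
theorem exists_prod_setLAverage_rpow_le {s q : ℝ} {Q : Fin m → ℝ} (hm : 1 ≤ m) (hs : 1 ≤ s)
    (hsQ : ∀ j, s ≤ Q j) (hq : 1 / q = ∑ j, 1 / Q j) {ω : Fin m → Rn n → ℝ≥0∞}
    (hω : IsMultipleAp (fun j => Q j / s) ω)
    (hfin : ∀ (y : Rn n) (r : ℝ),
      weightMeasure (geomWeight (fun j => q / Q j) ω) (ball y r) ≠ ∞) :
    ∃ C : ℝ≥0, ∀ f : Fin m → Rn n → 𝕜, (∀ j, AEStronglyMeasurable (f j) volume) →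
      ∀ (y : Rn n) (r : ℝ), 0 < r →
      ∏ j, ((volume (ball y r))⁻¹ * ∫⁻ x in ball y r, ‖f j x‖ₑ ^ s) ^ (1 / s) ≤
        C * weightMeasure (geomWeight (fun j => q / Q j) ω) (ball y r) ^ (-(1 / q)) *
          ∏ j, lebesgueNorm (Q j) (ω j) ((ball y r).indicator (f j)) := by
  have hs0 : 0 < s := by linarith
  have hQ0 : ∀ j, 0 < Q j := fun j => hs0.trans_le (hsQ j)
  have : Nonempty (Fin m) := ⟨⟨0, hm⟩⟩
  have hq0 : 0 < q := by
    rw [← one_div_pos, hq]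
    exact Finset.sum_pos (fun j _ => one_div_pos.2 (hQ0 j)) Finset.univ_nonempty
  obtain ⟨hw, C, hC⟩ := hω
  have hJ : jointExponent (fun j => Q j / s) = q / s := by
    have : ∑ j, 1 / (Q j / s) = s * ∑ j, 1 / Q j := by
      rw [Finset.mul_sum]
      exact Finset.sum_congr rfl fun j _ => by rw [one_div_div, mul_one_div]
    rw [jointExponent, this, ← hq]; field_simp
  have hν : productWeight (jointExponent fun j => Q j / s) (fun j => Q j / s) ω =
      geomWeight (fun j => q / Q j) ω := by
    funext x
    simp only [productWeight, geomWeight, hJ]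
    refine Finset.prod_congr rfl fun j _ => ?_
    rw [div_div_div_cancel_right₀ hs0.ne']
  refine ⟨C ^ (1 / s), fun f hf y r hr => ?_⟩
  set ν := geomWeight (fun j => q / Q j) ω with hνdef
  have hV0 := volume_ball_ne_zero y hr
  have hVt := volume_ball_ne_top y r
  set V := volume (ball y r) with hV
  have hνw : IsWeight ν := isWeight_geomWeight hw
  have hM0 := hνw.setLAverage_ne_zero y hr
  have hB := weightMeasure_ball ν y hr
  have hMt : ⨍⁻ x in ball y r, ν x ∂volume ≠ ∞ := fun ht => hfin y r (by
    rw [hB, ht, ENNReal.mul_top hV0])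
  set M := ⨍⁻ x in ball y r, ν x ∂volume with hM
  have hA := ENNReal.rpow_le_rpow (hC y r hr) (z := 1 / s) (by positivity)
  rw [hν, hJ, ENNReal.mul_rpow_of_nonneg _ _ (by positivity), ← ENNReal.rpow_mul,
    show 1 / (q / s) * (1 / s) = 1 / q by field_simp, ← hM] at hA
  -- The powers of the volume cancel because `1 / q` is the sum of the `1 / Q j`.
  have hVprod : ∏ j, V ^ (-(1 / Q j)) = V ^ (-(1 / q)) := by
    simp_rw [ENNReal.rpow_neg]
    rw [hq, ← prod_rpow_const _ fun j _ => (one_div_pos.2 (hQ0 j)).le,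
      ENNReal.prod_inv_distrib]
    intro i _ j _ _
    exact Or.inr (ENNReal.rpow_ne_top_of_ne_zero hV0 hVt)
  set N := ∏ j, lebesgueNorm (Q j) (ω j) ((ball y r).indicator (f j)) with hN
  calc ∏ j, (V⁻¹ * ∫⁻ x in ball y r, ‖f j x‖ₑ ^ s) ^ (1 / s)
      ≤ ∏ j, (V ^ (-(1 / Q j)) * lebesgueNorm (Q j) (ω j) ((ball y r).indicator (f j)) *
        dualAverage (Q j / s) (ω j) y r ^ (1 / s)) :=
        Finset.prod_le_prod' fun j _ =>
          setLAverage_rpow_le_lebesgueNorm hs (hsQ j) (hw j) (hf j) y r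
    _ = V ^ (-(1 / q)) * N * (∏ j, dualAverage (Q j / s) (ω j) y r) ^ (1 / s) := by
        rw [Finset.prod_mul_distrib, Finset.prod_mul_distrib, hVprod,
          ENNReal.prod_rpow_of_nonneg (by positivity)]
    _ = V ^ (-(1 / q)) * N * (M ^ (-(1 / q)) *
          (M ^ (1 / q) * (∏ j, dualAverage (Q j / s) (ω j) y r) ^ (1 / s))) := by
        rw [← mul_assoc (M ^ (-(1 / q))), ← ENNReal.rpow_add _ _ hM0 hMt, neg_add_cancel,
          ENNReal.rpow_zero, one_mul]
    _ ≤ V ^ (-(1 / q)) * N * (M ^ (-(1 / q)) * (C : ℝ≥0∞) ^ (1 / s)) := by gcongr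
    _ = _ := by
        rw [hB, ENNReal.mul_rpow_of_ne_top hVt hMt, ENNReal.coe_rpow_of_nonneg _ (by positivity)]
        ring

end LocalNorms

variable {n m : ℕ} {𝕜 : Type*} [RCLike 𝕜]

/-! ### Decomposition of a multisublinear operator -/

theorem IsMultisublinearOn.norm_map_add_le_sum {D : Fin m → Set (Rn n → 𝕜)}
    {T : (Fin m → Rn n → 𝕜) → Rn n → 𝕜} (hT : IsMultisublinearOn D T) {g h : Fin m → Rn n → 𝕜}
    (hg : ∀ j, g j ∈ D j) (hh : ∀ j, h j ∈ D j) (hgh : ∀ j, g j + h j ∈ D j) :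
    ∀ᵐ x ∂(volume : Measure (Rn n)), ‖T (fun j => g j + h j) x‖ ≤
      ∑ σ : Finset (Fin m), ‖T (fun j => if j ∈ σ then h j else g j) x‖ := by
  -- The first `S` variables are split one after the other.
  have key : ∀ S : Finset (Fin m), ∀ᵐ x ∂(volume : Measure (Rn n)),
      ‖T (fun j => g j + h j) x‖ ≤ ∑ σ ∈ S.powerset,
        ‖T (fun j => if j ∈ S then (if j ∈ σ then h j else g j) else g j + h j) x‖ := by
    intro S
    induction S using Finset.induction_on with
    | empty => simp
    | insert i S hi ih =>
      have hstep : ∀ σ ∈ S.powerset, ∀ᵐ x ∂(volume : Measure (Rn n)),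
          ‖T (fun j => if j ∈ S then (if j ∈ σ then h j else g j) else g j + h j) x‖ ≤
          ‖T (fun j => if j ∈ insert i S then (if j ∈ σ then h j else g j) else g j + h j) x‖ +
          ‖T (fun j => if j ∈ insert i S then (if j ∈ insert i σ then h j else g j)
            else g j + h j) x‖ := by
        intro σ hσ
        have hiσ : i ∉ σ := fun h => hi (Finset.mem_powerset.1 hσ h)
        set F : Fin m → Rn n → 𝕜 :=
          fun j => if j ∈ S then (if j ∈ σ then h j else g j) else g j + h j with hF
        have h0 : F = Function.update F i (g i + h i) := by
          rw [Function.eq_update_self_iff]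
          simp [hF, hi]
        have h1 : (fun j => if j ∈ insert i S then (if j ∈ σ then h j else g j)
            else g j + h j) = Function.update F i (g i) := by
          funext j
          by_cases hj : j = i
          · subst hj; simp [hiσ]
          · simp [hj, hF]
        have h2 : (fun j => if j ∈ insert i S then (if j ∈ insert i σ then h j else g j)
            else g j + h j) = Function.update F i (h i) := by
          funext j
          by_cases hj : j = i
          · subst hj; simp
          · simp [hj, hF]
        have hFD : ∀ j, F j ∈ D j := by
          intro j
          simp only [hF]
          split_ifs
          exacts [hh j, hg j, hgh j]
        rw [h1, h2]
        conv in T F => rw [h0]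
        exact hT.add_le F hFD i (g i) (hg i) (h i) (hh i)
      have hall := (Filter.eventually_all_finset S.powerset).2 hstep
      filter_upwards [ih, hall] with x hx hx'
      refine hx.trans ((Finset.sum_le_sum hx').trans (le_of_eq ?_))
      rw [Finset.sum_powerset_insert hi, Finset.sum_add_distrib]
  simpa using key Finset.univ

/-! ### Quasi-triangle inequalities -/

/-- The quasi-triangle inequality for the sum of a function and a constant on a ball, which is
all that is used of the local quasi-norm `N` in an amalgam space. -/
def IsLocallyQuasiAdditive (N : (Rn n → 𝕜) → ℝ≥0∞) (q : ℝ) (μ : Measure (Rn n)) : Prop :=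
  ∃ C : ℝ≥0, ∀ (F G : Rn n → 𝕜) (y : Rn n) (r : ℝ) (K : ℝ≥0∞),
    (∀ᵐ x ∂(volume.restrict (ball y r)), ‖F x‖ₑ ≤ ‖G x‖ₑ + K) →
      N ((ball y r).indicator F) ≤ C * (N G + K * μ (ball y r) ^ (1 / q))

theorem isLocallyQuasiAdditive_lebesgueNorm {q : ℝ} (hq : 0 < q) (ω : Rn n → ℝ≥0∞) :
    IsLocallyQuasiAdditive (𝕜 := 𝕜) (lebesgueNorm q ω) q (weightMeasure ω) := by
  refine ⟨2 * 2 ^ (1 / q), fun F G y r K h => ?_⟩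
  have hae : ∀ᵐ x ∂((weightMeasure ω).restrict (ball y r)), ‖F x‖ₑ ≤ ‖G x‖ₑ + K :=
    ((weightMeasure_absolutelyContinuous ω).restrict _).ae_le h
  have h1 : ∫⁻ x in ball y r, ‖F x‖ₑ ^ q ∂(weightMeasure ω) ≤
      2 ^ q * (∫⁻ x, ‖G x‖ₑ ^ q ∂(weightMeasure ω) + K ^ q * weightMeasure ω (ball y r)) := by
    calc ∫⁻ x in ball y r, ‖F x‖ₑ ^ q ∂(weightMeasure ω)
        ≤ ∫⁻ x in ball y r, 2 ^ q * (‖G x‖ₑ ^ q + K ^ q) ∂(weightMeasure ω) := by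
          refine lintegral_mono_ae ?_
          filter_upwards [hae] with x hx
          exact (ENNReal.rpow_le_rpow hx hq.le).trans
            (ENNReal.add_rpow_le_two_rpow_mul_rpow_add_rpow _ _ hq.le)
      _ = 2 ^ q * (∫⁻ x in ball y r, ‖G x‖ₑ ^ q ∂(weightMeasure ω) +
            K ^ q * weightMeasure ω (ball y r)) := by
          rw [lintegral_const_mul' _ _ (ENNReal.rpow_ne_top_of_nonneg hq.le (by simp)),
            lintegral_add_right _ measurable_const, setLIntegral_const]
      _ ≤ _ := by
          gcongr
          exact Measure.restrict_le_self
  have hq' : 0 ≤ 1 / q := by positivity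
  rw [lebesgueNorm_indicator_ball_eq_lintegral hq]
  refine (ENNReal.rpow_le_rpow h1 hq').trans ?_
  rw [ENNReal.mul_rpow_of_nonneg _ _ hq', ← ENNReal.rpow_mul, mul_one_div_cancel hq.ne',
    ENNReal.rpow_one, ENNReal.coe_mul, ENNReal.coe_rpow_of_nonneg _ hq', mul_assoc]
  push_cast
  gcongr
  refine (ENNReal.add_rpow_le_two_rpow_mul_rpow_add_rpow _ _ hq').trans (le_of_eq ?_)
  rw [ENNReal.mul_rpow_of_nonneg _ _ hq', ← ENNReal.rpow_mul, mul_one_div_cancel hq.ne',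
    ENNReal.rpow_one, lebesgueNorm, eLpNorm'_eq_lintegral_enorm]

theorem isLocallyQuasiAdditive_weakLebesgueNorm {q : ℝ} (hq : 0 < q) (ω : Rn n → ℝ≥0∞) :
    IsLocallyQuasiAdditive (𝕜 := 𝕜) (weakLebesgueNorm q ω) q (weightMeasure ω) := by
  refine ⟨2, fun F G y r K h => iSup_le fun t => ?_⟩
  have hae : ∀ᵐ x ∂((weightMeasure ω).restrict (ball y r)), ‖F x‖ₑ ≤ ‖G x‖ₑ + K :=
    ((weightMeasure_absolutelyContinuous ω).restrict _).ae_le h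
  rw [ae_restrict_iff' measurableSet_ball] at hae
  have hq' : 0 ≤ 1 / q := by positivity
  have ht : (t : ℝ≥0∞) = 2 * ((t / 2 : ℝ≥0) : ℝ≥0∞) := by
    rw [← ENNReal.coe_ofNat, ← ENNReal.coe_mul, mul_div_cancel₀ _ (two_ne_zero)]
  rw [mul_add]
  -- Either `K` or `|G|` exceeds `t / 2` where `|F| > t`.
  rcases le_or_gt ((t / 2 : ℝ≥0) : ℝ≥0∞) K with hK | hK
  · refine le_add_left ?_
    rw [ht, mul_assoc, ENNReal.coe_ofNat]
    gcongr
    intro x hx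
    by_contra hxB
    simp [hxB] at hx
  · refine le_add_right ?_
    have hsub : weightMeasure ω {x | (t : ℝ≥0∞) < ‖(ball y r).indicator F x‖ₑ} ≤
        weightMeasure ω {x | ((t / 2 : ℝ≥0) : ℝ≥0∞) < ‖G x‖ₑ} := by
      refine measure_mono_ae ?_
      filter_upwards [hae] with x hx (hxt : _ < _)
      by_cases hxB : x ∈ ball y r
      · rw [Set.indicator_of_mem hxB] at hxt
        by_contra hG
        have hG' : ‖G x‖ₑ ≤ ((t / 2 : ℝ≥0) : ℝ≥0∞) := not_lt.1 hG
        refine absurd (hxt.trans_le (hx hxB)) (not_lt.2 ?_)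
        rw [ht, two_mul]
        exact add_le_add hG' hK.le
      · simp [hxB] at hxt
    calc (t : ℝ≥0∞) * weightMeasure ω {x | (t : ℝ≥0∞) < ‖(ball y r).indicator F x‖ₑ} ^ (1 / q)
        ≤ 2 * (((t / 2 : ℝ≥0) : ℝ≥0∞) *
          weightMeasure ω {x | ((t / 2 : ℝ≥0) : ℝ≥0∞) < ‖G x‖ₑ} ^ (1 / q)) := by
          rw [← mul_assoc, ← ht]
          gcongr
      _ ≤ 2 * weakLebesgueNorm q ω G := by
          gcongr
          exact le_iSup (fun t : ℝ≥0 => (t : ℝ≥0∞) *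
            weightMeasure ω {x | (t : ℝ≥0∞) < ‖G x‖ₑ} ^ (1 / q)) (t / 2)

/-! ### The off-diagonal bound -/

theorem inv_volume_mul_setLIntegral_rpow_le {s : ℝ} (hs : 1 ≤ s) (F : Rn n → ℝ≥0∞) (y : Rn n)
    {r : ℝ} (hr : 0 < r) (k : ℕ) :
    ((2 : ℝ≥0∞) ^ (n * k))⁻¹ *
        ((volume (ball y (2 * r)))⁻¹ * ∫⁻ z in ball y (2 * r), F z) ^ (1 / s) ≤
      ((volume (ball y (2 ^ (k + 1) * r)))⁻¹ *
        ∫⁻ z in ball y (2 ^ (k + 1) * r), F z) ^ (1 / s) := by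
  have hv : volume (ball y (2 ^ (k + 1) * r)) = 2 ^ (n * k) * volume (ball y (2 * r)) := by
    rw [show (2 : ℝ) ^ (k + 1) * r = 2 ^ k * (2 * r) by ring, volume_ball_mul y y (by positivity),
      ← pow_mul, mul_comm k n, ENNReal.ofReal_pow (by norm_num), ENNReal.ofReal_ofNat]
  have h0 : (2 : ℝ≥0∞) ^ (n * k) ≠ 0 := by simp
  have ht : (2 : ℝ≥0∞) ^ (n * k) ≠ ∞ := by simp
  have h1 : ((2 : ℝ≥0∞) ^ (n * k))⁻¹ ≤ (((2 : ℝ≥0∞) ^ (n * k))⁻¹) ^ (1 / s) := by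
    refine ENNReal.rpow_le_rpow_of_exponent_ge (y := 1) (z := 1 / s) ?_ ?_ |>.trans' ?_
    · exact ENNReal.inv_le_one.2 (one_le_pow₀ (by norm_num))
    · rw [div_le_one (by positivity)]; exact hs
    · rw [ENNReal.rpow_one]
  rw [hv, ENNReal.mul_inv (Or.inl h0) (Or.inl ht), mul_assoc,
    ENNReal.mul_rpow_of_nonneg (2 ^ (n * k))⁻¹ _ (by positivity : (0 : ℝ) ≤ 1 / s)]
  refine mul_le_mul' h1 ?_
  gcongr
  linarith [one_le_pow₀ (M₀ := ℝ) (by norm_num : (1 : ℝ) ≤ 2) (n := k), pow_succ (2 : ℝ) k]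

/-- The factors `2 ^ (-nk)` turn the means over `2B` into means over `2 ^ (k + 1) B`, after which
no index plays a special role. -/
theorem offDiagonalBound_le_tsum {s : ℝ} (hs : 1 ≤ s) (f : Fin m → Rn n → 𝕜)
    (σ : Finset (Fin m)) (y : Rn n) {r : ℝ} (hr : 0 < r) :
    offDiagonalBound s f σ y r ≤ ∑' k : ℕ, (k : ℝ≥0∞) *
      ∏ j, ((volume (ball y (2 ^ (k + 1) * r)))⁻¹ *
        ∫⁻ z in ball y (2 ^ (k + 1) * r), ‖f j z‖ₑ ^ s) ^ (1 / s) := by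
  rw [offDiagonalBound, ← ENNReal.tsum_mul_left]
  refine ENNReal.tsum_le_tsum fun k => ?_
  have hpow : ((k : ℝ≥0∞) / 2 ^ (n * k * σᶜ.card)) =
      k * ∏ _j ∈ σᶜ, ((2 : ℝ≥0∞) ^ (n * k))⁻¹ := by
    rw [Finset.prod_const, ← ENNReal.inv_pow, ← pow_mul, div_eq_mul_inv]
  rw [hpow, ← Finset.prod_compl_mul_prod σ]
  calc _ = (k : ℝ≥0∞) * ((∏ j ∈ σᶜ, ((2 : ℝ≥0∞) ^ (n * k))⁻¹ *
          ((volume (ball y (2 * r)))⁻¹ * ∫⁻ z in ball y (2 * r), ‖f j z‖ₑ ^ s) ^ (1 / s)) *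
        ∏ j ∈ σ, ((volume (ball y (2 ^ (k + 1) * r)))⁻¹ *
          ∫⁻ z in ball y (2 ^ (k + 1) * r) \ ball y (2 ^ k * r), ‖f j z‖ₑ ^ s) ^ (1 / s)) := by
        rw [Finset.prod_mul_distrib]; ring
    _ ≤ _ := by
        gcongr with j _ j _
        · exact inv_volume_mul_setLIntegral_rpow_le hs _ y hr k
        · exact Set.sdiff_subset

/-! ### Outer `L^p` norms -/

section OuterNorm

variable {X : Type*} [MeasurableSpace X] {μ : Measure X}

/-- Hölder's inequality for the outer norms, `0 < p ≤ ∞`. -/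
theorem eLpNorm_prod_le {p : ℝ≥0∞} (hp0 : p ≠ 0) {P : Fin m → ℝ≥0∞} {θ : Fin m → ℝ}
    (hθ : ∀ j, 0 < θ j) (hθ1 : ∑ j, θ j = 1) (hP : ∀ j, (P j)⁻¹ = ENNReal.ofReal (θ j) * p⁻¹)
    {g : Fin m → X → ℝ≥0∞} (hg : ∀ j, Measurable (g j)) :
    eLpNorm (fun x => ∏ j, g j x) p μ ≤ ∏ j, eLpNorm (g j) (P j) μ := by
  by_cases hp : p = ∞
  · have hPt : ∀ j, P j = ∞ := fun j => by simpa [hp] using hP j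
    simp only [hp, hPt, eLpNorm_exponent_top]
    refine essSup_le_of_ae_le _ ?_
    filter_upwards [ae_all_iff.2 fun j => ae_le_eLpNormEssSup (f := g j) (μ := μ)] with x hx
    exact Finset.prod_le_prod' fun j _ => hx j
  · have hpr : 0 < p.toReal := ENNReal.toReal_pos hp0 hp
    have hPr : ∀ j, (P j).toReal = p.toReal / θ j := fun j => by
      have := congrArg ENNReal.toReal (hP j)
      rw [ENNReal.toReal_inv, ENNReal.toReal_mul, ENNReal.toReal_inv,
        ENNReal.toReal_ofReal (hθ j).le] at this
      rw [← inv_inj, this, inv_div, div_eq_mul_inv]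
    have hP0 : ∀ j, P j ≠ 0 := fun j h => by
      have := hPr j
      rw [h, ENNReal.toReal_zero] at this
      exact (div_pos hpr (hθ j)).ne this
    have hPt : ∀ j, P j ≠ ∞ := fun j h => by
      have := hPr j
      rw [h, ENNReal.toReal_top] at this
      exact (div_pos hpr (hθ j)).ne this
    rw [eLpNorm_eq_lintegral_rpow_enorm_toReal hp0 hp]
    have hH := ENNReal.lintegral_prod_norm_pow_le (μ := μ) Finset.univ
      (f := fun j x => g j x ^ (P j).toReal) (fun j _ => ((hg j).pow_const _).aemeasurable)
      hθ1 fun j _ => (hθ j).le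
    calc _ = (∫⁻ x, ∏ j, (g j x ^ (P j).toReal) ^ θ j ∂μ) ^ (1 / p.toReal) := by
          congr 1
          refine lintegral_congr fun x => ?_
          rw [enorm_eq_self, ← ENNReal.prod_rpow_of_nonneg hpr.le]
          refine Finset.prod_congr rfl fun j _ => ?_
          rw [← ENNReal.rpow_mul, hPr, div_mul_cancel₀ _ (hθ j).ne']
      _ ≤ (∏ j, (∫⁻ x, g j x ^ (P j).toReal ∂μ) ^ θ j) ^ (1 / p.toReal) := by gcongr
      _ = _ := by
          rw [← ENNReal.prod_rpow_of_nonneg (by positivity)]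
          refine Finset.prod_congr rfl fun j _ => ?_
          rw [eLpNorm_eq_lintegral_rpow_enorm_toReal (hP0 j) (hPt j), ← ENNReal.rpow_mul]
          simp only [enorm_eq_self]
          congr 1
          rw [hPr]
          have := (hθ j).ne'
          field_simp

theorem tsum_add_one_mul_pow_ne_top {τ : ℝ≥0} (hτ : τ < 1) :
    ∑' k : ℕ, ((k : ℝ≥0∞) + 1) * τ ^ k ≠ ∞ := by
  have h : Summable fun k : ℕ => ((k : ℝ) + 1) * (τ : ℝ) ^ k := by
    have hτ' : ‖(τ : ℝ)‖ < 1 := by simpa using hτ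
    have h1 := summable_pow_mul_geometric_of_norm_lt_one 1 hτ'
    refine (h1.add (summable_geometric_of_norm_lt_one hτ')).congr fun k => ?_
    ring
  have h' : Summable fun k : ℕ => ((k : ℝ≥0) + 1) * τ ^ k := by
    rw [← NNReal.summable_coe]
    exact_mod_cast h
  have := ENNReal.tsum_coe_ne_top_iff_summable.2 h'
  simpa using this

/-- The outer norm of a geometrically decaying sum. For `p < 1` there is no Minkowski inequality;
for all `p` at once, the sum is bounded by a supremum, and the `p`-th power of the supremum
by a sum. -/
theorem exists_eLpNorm_tsum_le {p : ℝ≥0∞} (hp0 : p ≠ 0) {τ : ℝ≥0} (hτ : τ < 1) :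
    ∃ C : ℝ≥0, ∀ {X : Type} [MeasurableSpace X] {μ : Measure X} (a : ℕ → X → ℝ≥0∞) (M : ℝ≥0∞),
      (∀ k, Measurable (a k)) → (∀ k, eLpNorm (a k) p μ ≤ M) →
      eLpNorm (fun x => ∑' k : ℕ, ((k : ℝ≥0∞) + 1) * (τ ^ k * τ ^ k) * a k x) p μ ≤ C * M := by
  set S : ℝ≥0∞ := ∑' k : ℕ, ((k : ℝ≥0∞) + 1) * τ ^ k with hSdef
  have hS : S ≠ ∞ := tsum_add_one_mul_pow_ne_top hτ
  have hle {X : Type} (a : ℕ → X → ℝ≥0∞) (x : X) :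
      ∑' k : ℕ, ((k : ℝ≥0∞) + 1) * (τ ^ k * τ ^ k) * a k x ≤
        S * ⨆ k, (τ : ℝ≥0∞) ^ k * a k x := by
    rw [hSdef, ← ENNReal.tsum_mul_right]
    refine ENNReal.tsum_le_tsum fun k => ?_
    rw [← mul_assoc, mul_assoc _ _ (a k x)]
    gcongr
    exact le_iSup (fun k => (τ : ℝ≥0∞) ^ k * a k x) k
  have hτ1 : (τ : ℝ≥0∞) < 1 := by exact_mod_cast hτ
  by_cases hp : p = ∞
  · refine ⟨S.toNNReal, fun a M _ hM => ?_⟩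
    rw [ENNReal.coe_toNNReal hS, hp, eLpNorm_exponent_top]
    refine essSup_le_of_ae_le _ ?_
    filter_upwards [ae_all_iff.2 fun k => ae_le_eLpNormEssSup (f := a k)] with x hx
    refine (hle a x).trans ?_
    gcongr
    refine iSup_le fun k => (mul_le_of_le_one_left' (pow_le_one₀ zero_le hτ1.le)).trans ?_
    refine (hx k).trans ?_
    simpa [hp] using hM k
  · have hpr : 0 < p.toReal := ENNReal.toReal_pos hp0 hp
    have hgeo : (1 - (τ : ℝ≥0∞) ^ p.toReal)⁻¹ ≠ ∞ := by
      rw [Ne, ENNReal.inv_eq_top, tsub_eq_zero_iff_le, not_le]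
      exact ENNReal.rpow_lt_one hτ1 hpr
    have hC := ENNReal.rpow_ne_top_of_nonneg (one_div_pos.2 hpr).le hgeo
    refine ⟨(S * (1 - (τ : ℝ≥0∞) ^ p.toReal)⁻¹ ^ (1 / p.toReal)).toNNReal,
      fun {X} _ {μ} a M ha hM => ?_⟩
    rw [ENNReal.coe_toNNReal (ENNReal.mul_ne_top hS hC),
      eLpNorm_eq_lintegral_rpow_enorm_toReal hp0 hp, one_div, ENNReal.rpow_inv_le_iff hpr]
    have hk : ∀ k, ∫⁻ x, a k x ^ p.toReal ∂μ ≤ M ^ p.toReal := fun k => by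
      have := hM k
      rwa [eLpNorm_eq_lintegral_rpow_enorm_toReal hp0 hp, one_div,
        ENNReal.rpow_inv_le_iff hpr] at this
    calc ∫⁻ x, ‖∑' k : ℕ, ((k : ℝ≥0∞) + 1) * (τ ^ k * τ ^ k) * a k x‖ₑ ^ p.toReal ∂μ
        ≤ ∫⁻ x, S ^ p.toReal * ∑' k : ℕ, ((τ : ℝ≥0∞) ^ p.toReal) ^ k * a k x ^ p.toReal ∂μ := by
          refine lintegral_mono fun x => ?_
          refine (ENNReal.rpow_le_rpow (hle a x) hpr.le).trans ?_
          rw [ENNReal.mul_rpow_of_nonneg _ _ hpr.le]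
          gcongr
          rw [← ENNReal.le_rpow_inv_iff hpr]
          refine iSup_le fun k => ?_
          rw [ENNReal.le_rpow_inv_iff hpr, ENNReal.mul_rpow_of_nonneg _ _ hpr.le,
            ← ENNReal.rpow_natCast_mul, mul_comm (k : ℝ), ENNReal.rpow_mul_natCast]
          exact ENNReal.le_tsum (f := fun k => ((τ : ℝ≥0∞) ^ p.toReal) ^ k * a k x ^ p.toReal) k
      _ = S ^ p.toReal * ∑' k : ℕ, ((τ : ℝ≥0∞) ^ p.toReal) ^ k *
            ∫⁻ x, a k x ^ p.toReal ∂μ := by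
          rw [lintegral_const_mul' _ _ (ENNReal.rpow_ne_top_of_nonneg hpr.le hS), lintegral_tsum
            fun k => (((ha k).pow_const _).const_mul _).aemeasurable]
          congr 2
          funext k
          rw [lintegral_const_mul _ ((ha k).pow_const _)]
      _ ≤ S ^ p.toReal * ∑' k : ℕ, ((τ : ℝ≥0∞) ^ p.toReal) ^ k * M ^ p.toReal := by
          gcongr with k
          exact hk k
      _ = (S * (1 - (τ : ℝ≥0∞) ^ p.toReal)⁻¹ ^ p.toReal⁻¹ * M) ^ p.toReal := by
          rw [ENNReal.tsum_mul_right, ENNReal.tsum_geometric,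
            ENNReal.mul_rpow_of_nonneg _ _ hpr.le, ENNReal.mul_rpow_of_nonneg _ _ hpr.le,
            ENNReal.rpow_inv_rpow hpr.ne', mul_assoc]

end OuterNorm

/-! ### Elements of amalgam spaces -/

theorem ae_lt_top_of_eLpNorm_lt_top {X : Type*} [MeasurableSpace X] {μ : Measure X} {p : ℝ≥0∞}
    (hp0 : p ≠ 0) {g : X → ℝ≥0∞} (hg : Measurable g) (h : eLpNorm g p μ < ∞) :
    ∀ᵐ x ∂μ, g x < ∞ := by
  by_cases hp : p = ∞
  · rw [hp, eLpNorm_exponent_top] at h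
    filter_upwards [ae_le_eLpNormEssSup (f := g) (μ := μ)] with x hx
    exact hx.trans_lt h
  · have hpr : 0 < p.toReal := ENNReal.toReal_pos hp0 hp
    rw [eLpNorm_eq_lintegral_rpow_enorm_toReal hp0 hp,
      ENNReal.rpow_lt_top_iff_of_pos (by positivity)] at h
    filter_upwards [ae_lt_top (by fun_prop) h.ne] with x hx
    exact (ENNReal.rpow_lt_top_iff_of_pos hpr).1 hx

theorem amalgamNorm_indicator_le {q : ℝ} (hq : 0 < q) (ω : Rn n → ℝ≥0∞) (p : ℝ≥0∞) (α : ℝ)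
    (f : Rn n → 𝕜) (s : Set (Rn n)) : amalgamNorm q ω p α (s.indicator f) ≤
      amalgamNorm q ω p α f := by
  refine iSup₂_mono fun r _ => eLpNorm_mono_enorm fun y => ?_
  simp only [enorm_eq_self]
  gcongr
  refine lebesgueNorm_mono hq ω fun x => ?_
  rw [Set.indicator_indicator, Set.inter_comm, ← Set.indicator_indicator]
  exact enorm_indicator_le_enorm_self _ _

theorem indicator_mem_spaceOf_amalgamNorm {q : ℝ} (hq : 0 < q) {ω : Rn n → ℝ≥0∞} {p : ℝ≥0∞}
    {α : ℝ} {f : Rn n → 𝕜} (hf : f ∈ spaceOf (amalgamNorm q ω p α)) {s : Set (Rn n)}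
    (hs : MeasurableSet s) : s.indicator f ∈ spaceOf (amalgamNorm q ω p α) :=
  ⟨hf.1.indicator hs, (amalgamNorm_indicator_le hq ω p α f s).trans_lt hf.2⟩

theorem spaceOf_amalgamNorm_subset_sumSpace {q : ℝ} (hq : 0 < q) (ω : Rn n → ℝ≥0∞) (p : ℝ≥0∞)
    (α : ℝ) : spaceOf (amalgamNorm (𝕜 := 𝕜) q ω p α) ⊆ sumSpace 𝕜 q ω p α := by
  intro f hf
  refine ⟨0, ⟨aestronglyMeasurable_zero, ?_⟩, f, hf, (zero_add f).symm⟩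
  simp [lebesgueNorm, eLpNorm'_zero hq]

theorem ae_lebesgueNorm_indicator_ball_lt_top {q : ℝ} (hq : 0 < q) {ω : Rn n → ℝ≥0∞}
    (hω : IsAInfty ω) {p : ℝ≥0∞} (hp0 : p ≠ 0) {α : ℝ} {f : Rn n → 𝕜}
    (hf : f ∈ spaceOf (amalgamNorm q ω p α)) {r : ℝ} (hr : 0 < r) :
    ∀ᵐ y ∂(volume : Measure (Rn n)), lebesgueNorm q ω ((ball y r).indicator f) < ∞ := by
  have h1 : eLpNorm (fun y : Rn n => weightMeasure ω (ball y r) ^ (1 / α - 1 / q - 1 / p.toReal)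
      * lebesgueNorm q ω ((ball y r).indicator f)) p volume < ∞ :=
    (le_iSup₂ (f := fun (r : ℝ) (_ : 0 < r) => eLpNorm (fun y : Rn n =>
      weightMeasure ω (ball y r) ^ (1 / α - 1 / q - 1 / p.toReal)
        * lebesgueNorm q ω ((ball y r).indicator f)) p volume) r hr).trans_lt hf.2
  filter_upwards [ae_lt_top_of_eLpNorm_lt_top hp0 (((measurable_measure_ball r).pow_const _).mul
    (measurable_lebesgueNorm_indicator_ball hq ω f r)) h1] with y hy
  by_contra h
  rw [not_lt, top_le_iff] at h
  rw [Pi.mul_apply, h, ENNReal.mul_top] at hy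
  · exact lt_irrefl _ hy
  · exact (ENNReal.rpow_pos (pos_iff_ne_zero.2 (hω.isWeight.weightMeasure_ball_ne_zero y hr))
      (hω.weightMeasure_ball_ne_top y r)).ne'

/-! ### The local estimate -/

theorem rpow_le_mul_rpow_of_nonpos {a b : ℝ≥0∞} {C : ℝ≥0∞} (h : a ≤ C * b) (ha0 : a ≠ 0)
    (ha : a ≠ ∞) (hb0 : b ≠ 0) (hb : b ≠ ∞) {δ : ℝ} (hδ : δ ≤ 0) :
    b ^ δ ≤ C ^ (-δ) * a ^ δ := by
  have h1 := ENNReal.rpow_le_rpow h (neg_nonneg.2 hδ)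
  rw [ENNReal.mul_rpow_of_nonneg _ _ (neg_nonneg.2 hδ)] at h1
  calc b ^ δ = a ^ (-δ) * (a ^ δ * b ^ δ) := by
        rw [← mul_assoc, ← ENNReal.rpow_add _ _ ha0 ha, neg_add_cancel, ENNReal.rpow_zero, one_mul]
    _ ≤ C ^ (-δ) * b ^ (-δ) * (a ^ δ * b ^ δ) := by gcongr
    _ = C ^ (-δ) * a ^ δ * (b ^ (-δ) * b ^ δ) := by ring
    _ = C ^ (-δ) * a ^ δ := by
        rw [← ENNReal.rpow_add _ _ hb0 hb, neg_add_cancel, ENNReal.rpow_zero, mul_one]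

/-- Subadditivity and the off-diagonal condition on a ball `B`: up to a constant function
on `B`, only the local parts `fⱼ χ_{2B}` contribute. -/
theorem exists_enorm_map_le_add_tsum {s : ℝ} (hs : 1 ≤ s) {Q A : Fin m → ℝ} (hQ : ∀ j, 0 < Q j)
    {P : Fin m → ℝ≥0∞} {ω : Fin m → Rn n → ℝ≥0∞} {T : (Fin m → Rn n → 𝕜) → Rn n → 𝕜}
    (hT : IsMultisublinearOn (fun j => sumSpace 𝕜 (Q j) (ω j) (P j) (A j)) T)
    (hTs : OffDiagonalCondition s (fun j => sumSpace 𝕜 (Q j) (ω j) (P j) (A j)) T) :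
    ∃ C : ℝ≥0, ∀ f : Fin m → Rn n → 𝕜,
      (∀ j, f j ∈ spaceOf (amalgamNorm (Q j) (ω j) (P j) (A j))) →
      ∀ (y : Rn n) (r : ℝ), 0 < r → ∀ᵐ x ∂(volume.restrict (ball y r)),
        ‖T f x‖ₑ ≤ ‖T (fun j => (ball y (2 * r)).indicator (f j)) x‖ₑ +
          C * ∑' k : ℕ, (k : ℝ≥0∞) *
            ∏ j, ((volume (ball y (2 ^ (k + 1) * r)))⁻¹ *
              ∫⁻ z in ball y (2 ^ (k + 1) * r), ‖f j z‖ₑ ^ s) ^ (1 / s) := by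
  obtain ⟨C, hC⟩ := hTs
  refine ⟨(Finset.univ.erase (∅ : Finset (Fin m))).card * C, fun f hf y r hr => ?_⟩
  have hsub := fun j => spaceOf_amalgamNorm_subset_sumSpace (𝕜 := 𝕜) (hQ j) (ω j) (P j) (A j)
  have hloc : ∀ j, (ball y (2 * r)).indicator (f j) ∈ sumSpace 𝕜 (Q j) (ω j) (P j) (A j) :=
    fun j => hsub j (indicator_mem_spaceOf_amalgamNorm (hQ j) (hf j) measurableSet_ball)
  have hfar : ∀ j, ((ball y (2 * r))ᶜ).indicator (f j) ∈
      sumSpace 𝕜 (Q j) (ω j) (P j) (A j) :=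
    fun j => hsub j (indicator_mem_spaceOf_amalgamNorm (hQ j) (hf j) measurableSet_ball.compl)
  have hfD : ∀ j, f j ∈ sumSpace 𝕜 (Q j) (ω j) (P j) (A j) := fun j => hsub j (hf j)
  have hadd : ∀ j, (ball y (2 * r)).indicator (f j) + ((ball y (2 * r))ᶜ).indicator (f j) = f j :=
    fun j => Set.indicator_self_add_compl _ _
  have h1 := hT.norm_map_add_le_sum hloc hfar fun j => by rw [hadd]; exact hfD j
  simp only [hadd] at h1
  have h2 : ∀ᵐ x ∂(volume.restrict (ball y r)), ∀ σ ∈ Finset.univ.erase (∅ : Finset (Fin m)),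
      ‖T (splitTuple f σ y r) x‖ₑ ≤ C * offDiagonalBound s f σ y r := by
    refine (Filter.eventually_all_finset _).2 fun σ hσ => ?_
    exact hC f hfD σ (Finset.nonempty_iff_ne_empty.2 (Finset.ne_of_mem_erase hσ)) y r hr
  filter_upwards [ae_restrict_of_ae h1, h2] with x hx hx'
  have hx2 : ‖T f x‖ₑ ≤ ∑ σ : Finset (Fin m), ‖T (splitTuple f σ y r) x‖ₑ := by
    have e : ∀ z : 𝕜, ‖z‖ₑ = ENNReal.ofReal ‖z‖ := fun z => (ofReal_norm z).symm
    simp only [e]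
    rw [← ENNReal.ofReal_sum_of_nonneg fun _ _ => norm_nonneg _]
    exact ENNReal.ofReal_le_ofReal hx
  rw [← Finset.add_sum_erase _ _ (Finset.mem_univ ∅)] at hx2
  refine hx2.trans (add_le_add ?_ ?_)
  · have e : splitTuple f ∅ y r = fun j => (ball y (2 * r)).indicator (f j) := by
      funext j
      simp [splitTuple]
    rw [e]
  · refine (Finset.sum_le_card_nsmul _ _ _ fun σ hσ => (hx' σ hσ).trans (mul_le_mul_right
      (offDiagonalBound_le_tsum hs f σ y hr) _)).trans (le_of_eq ?_)
    rw [nsmul_eq_mul]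
    push_cast
    ring

/-! ### Boundedness on amalgam spaces -/

/-- Boundedness on amalgam spaces over an arbitrary local quasi-norm `N`, which is later taken to
be the strong or the weak Lebesgue norm. -/
theorem isBoundedOperator_amalgamOf (hn : 1 ≤ n) (hm : 1 ≤ m)
    {s : ℝ} {Q A : Fin m → ℝ} {P : Fin m → ℝ≥0∞} {q α : ℝ} {p : ℝ≥0∞}
    (hs : 1 ≤ s) (hsQ : ∀ j, s ≤ Q j) (hQA : ∀ j, Q j ≤ A j)
    (hAP : ∀ j, ENNReal.ofReal (A j) < P j)
    (hq : 1 / q = ∑ j, 1 / Q j) (hp : p⁻¹ = ∑ j, (P j)⁻¹) (hα : 1 / α = ∑ j, 1 / A j)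
    (hQPtie : ∀ j, (P j)⁻¹ = ENNReal.ofReal (q / Q j) * p⁻¹)
    (hQAtie : ∀ j, q / Q j = α / A j) {ω : Fin m → Rn n → ℝ≥0∞}
    (hω : IsMultipleAp (fun j => Q j / s) ω) (hω' : ∀ j, IsAInfty (ω j))
    {T : (Fin m → Rn n → 𝕜) → Rn n → 𝕜}
    (hT : IsMultisublinearOn (fun j => sumSpace 𝕜 (Q j) (ω j) (P j) (A j)) T)
    (hTs : OffDiagonalCondition s (fun j => sumSpace 𝕜 (Q j) (ω j) (P j) (A j)) T)
    {N : (Rn n → 𝕜) → ℝ≥0∞}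
    (hN : IsLocallyQuasiAdditive N q (weightMeasure (productWeight q Q ω)))
    (hTN : IsBoundedOperator (fun j => lebesgueNorm (Q j) (ω j)) N T) :
    IsBoundedOperator (fun j => amalgamNorm (Q j) (ω j) (P j) (A j))
      (amalgamOf N q (productWeight q Q ω) p α) T := by
  -- Exponents.
  have hQ0 : ∀ j, 0 < Q j := fun j => by linarith [hsQ j]
  have hA0 : ∀ j, 0 < A j := fun j => (hQ0 j).trans_le (hQA j)
  have hne : Nonempty (Fin m) := ⟨⟨0, hm⟩⟩
  have hq0 : 0 < q := by
    rw [← one_div_pos, hq]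
    exact Finset.sum_pos (fun j _ => one_div_pos.2 (hQ0 j)) Finset.univ_nonempty
  have hα0 : 0 < α := by
    rw [← one_div_pos, hα]
    exact Finset.sum_pos (fun j _ => one_div_pos.2 (hA0 j)) Finset.univ_nonempty
  have hP0 : ∀ j, P j ≠ 0 := fun j => (zero_le.trans_lt (hAP j)).ne'
  have hp0 : p ≠ 0 := by
    rw [← ENNReal.inv_ne_top, hp]
    exact ENNReal.sum_ne_top.2 fun j _ => ENNReal.inv_ne_top.2 (hP0 j)
  set θ : Fin m → ℝ := fun j => q / Q j with hθdef
  have hθ : ∀ j, 0 < θ j := fun j => div_pos hq0 (hQ0 j)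
  have hθ0 : ∀ j, 0 ≤ θ j := fun j => (hθ j).le
  have hθ1 : ∑ j, θ j = 1 := by
    calc ∑ j, θ j = q * ∑ j, 1 / Q j := by
          rw [Finset.mul_sum]
          exact Finset.sum_congr rfl fun j _ => (mul_one_div _ _).symm
      _ = 1 := by rw [← hq]; field_simp
  have hPθ : ∀ j, 1 / (P j).toReal = θ j * (1 / p.toReal) := fun j => by
    have := congrArg ENNReal.toReal (hQPtie j)
    rwa [ENNReal.toReal_inv, ENNReal.toReal_mul, ENNReal.toReal_inv,
      ENNReal.toReal_ofReal (hθ0 j), ← one_div, ← one_div] at this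
  have hAθ : ∀ j, 1 / A j = θ j * (1 / α) := fun j => by
    rw [show θ j = α / A j from hQAtie j]; field_simp
  have hQθ : ∀ j, 1 / Q j = θ j * (1 / q) := fun j => by
    simp only [hθdef]; field_simp
  set δ : ℝ := 1 / α - 1 / q - 1 / p.toReal with hδdef
  set κ : ℝ := 1 / α - 1 / p.toReal with hκdef
  have hδj : ∀ j, 1 / A j - 1 / Q j - 1 / (P j).toReal = θ j * δ := fun j => by
    rw [hAθ, hQθ, hPθ, hδdef]; ring
  have hδ : δ ≤ 0 := by
    have h1 : 1 / α ≤ 1 / q := by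
      rw [hα, hq]
      exact Finset.sum_le_sum fun j _ => one_div_le_one_div_of_le (hQ0 j) (hQA j)
    have h2 : 0 ≤ 1 / p.toReal := by positivity
    linarith
  have hκ : 0 < κ := by
    let j : Fin m := ⟨0, hm⟩
    have h1 : 1 / (P j).toReal < 1 / A j := by
      by_cases hPj : P j = ∞
      · rw [hPj, ENNReal.toReal_top, div_zero]; exact one_div_pos.2 (hA0 j)
      · refine one_div_lt_one_div_of_lt (hA0 j) ?_
        exact (ENNReal.ofReal_lt_iff_lt_toReal (hA0 j).le hPj).1 (hAP j)
    rw [hPθ, hAθ] at h1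
    exact sub_pos.2 (lt_of_mul_lt_mul_left h1 (hθ0 j))
  -- Weights.
  have hw : ∀ j, IsWeight (ω j) := fun j => (hω' j).isWeight
  have hνdef : productWeight q Q ω = geomWeight θ ω := rfl
  rw [hνdef] at hN ⊢
  set ν : Measure (Rn n) := weightMeasure (geomWeight θ ω) with hν
  have hν0 : ∀ (y : Rn n) {r : ℝ}, 0 < r → ν (ball y r) ≠ 0 := fun y r hr =>
    (isWeight_geomWeight hw).weightMeasure_ball_ne_zero y hr
  have hνt : ∀ (y : Rn n) (r : ℝ), ν (ball y r) ≠ ∞ := fun y r => by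
    rcases le_or_gt r 0 with hr | hr
    · simp [ball_eq_empty.2 hr]
    · exact ne_top_of_le_ne_top (ENNReal.prod_ne_top fun j _ => ENNReal.rpow_ne_top_of_nonneg
        (hθ0 j) ((hω' j).weightMeasure_ball_ne_top y r))
        (weightMeasure_geomWeight_ball_le hθ0 hθ1 hw y hr)
  obtain ⟨Cd, hCd⟩ := exists_prod_weightMeasure_double_ball_rpow_le hθ0 hθ1 hω'
  obtain ⟨ρ, hρ1, hρ⟩ := exists_weightMeasure_geomWeight_ball_le_pow_mul hn hθ0 hθ1 hω'
  obtain ⟨Ch, hCh⟩ := exists_prod_setLAverage_rpow_le (𝕜 := 𝕜) hm hs hsQ hq hω hνt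
  obtain ⟨C₁, hC₁⟩ := exists_enorm_map_le_add_tsum hs hQ0 hT hTs
  obtain ⟨CN, hCN⟩ := hN
  obtain ⟨C₀, hC₀⟩ := hTN
  set τ : ℝ≥0 := ρ ^ (κ / 2) with hτdef
  have hτ1 : τ < 1 := NNReal.rpow_lt_one hρ1 (by positivity)
  obtain ⟨CL, hCL⟩ := exists_eLpNorm_tsum_le hp0 hτ1
  have hτ2 : ∀ k : ℕ, ((ρ : ℝ≥0∞) ^ k) ^ κ = (τ : ℝ≥0∞) ^ k * (τ : ℝ≥0∞) ^ k := fun k => by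
    rw [hτdef, ENNReal.coe_rpow_of_nonneg _ (by positivity), ← mul_pow,
      ← ENNReal.rpow_add_of_nonneg _ _ (by positivity) (by positivity), add_halves,
      ← ENNReal.rpow_natCast_mul, mul_comm (k : ℝ), ENNReal.rpow_mul_natCast]
  -- Comparison of the powers of the measures of balls.
  have hballs : ∀ (y : Rn n) (r R : ℝ), 0 < r → 0 < R → R ≤ 2 * r →
      ν (ball y r) ^ δ ≤ (Cd : ℝ≥0∞) ^ (-δ) *
        ∏ j, weightMeasure (ω j) (ball y R) ^ (θ j * δ) := by
    intro y r R hr hR hRr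
    have hX : ∏ j, weightMeasure (ω j) (ball y R) ^ θ j ≤ Cd * ν (ball y r) :=
      (Finset.prod_le_prod' fun j _ => ENNReal.rpow_le_rpow
        (measure_mono (ball_subset_ball hRr)) (hθ0 j)).trans (hCd y r hr)
    have hXt : ∀ j ∈ Finset.univ, weightMeasure (ω j) (ball y R) ^ θ j ≠ ∞ := fun j _ =>
      ENNReal.rpow_ne_top_of_nonneg (hθ0 j) ((hω' j).weightMeasure_ball_ne_top y R)
    have hX0 : ∏ j, weightMeasure (ω j) (ball y R) ^ θ j ≠ 0 :=
      Finset.prod_ne_zero_iff.2 fun j _ => (ENNReal.rpow_pos (pos_iff_ne_zero.2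
        ((hw j).weightMeasure_ball_ne_zero y hR)) ((hω' j).weightMeasure_ball_ne_top y R)).ne'
    have := rpow_le_mul_rpow_of_nonpos hX hX0 (ENNReal.prod_ne_top hXt) (hν0 y hr) (hνt y r) hδ
    rw [← ENNReal.prod_rpow_of_ne_top hXt] at this
    simpa only [ENNReal.rpow_mul] using this
  set CD : ℝ≥0 := Cd ^ (-δ) with hCD
  have hCDc : (Cd : ℝ≥0∞) ^ (-δ) = CD := (ENNReal.coe_rpow_of_nonneg _ (neg_nonneg.2 hδ)).symm
  rw [hCDc] at hballs
  refine ⟨CN * CD * (C₀ + C₁ * Ch) * CL, fun f hf => ?_⟩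
  have hfD := fun j => spaceOf_amalgamNorm_subset_sumSpace (𝕜 := 𝕜) (hQ0 j) (ω j) (P j) (A j)
    (hf j)
  suffices hmain : amalgamOf N q (geomWeight θ ω) p α (T f) ≤
      (CN * CD * (C₀ + C₁ * Ch) * CL : ℝ≥0) *
        ∏ j, amalgamNorm (Q j) (ω j) (P j) (A j) (f j) from
    ⟨⟨hT.aestronglyMeasurable f hfD, hmain.trans_lt (ENNReal.mul_lt_top ENNReal.coe_lt_top
      (ENNReal.prod_lt_top fun j _ => (hf j).2))⟩, hmain⟩
  refine iSup₂_le fun r hr => ?_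
  let R : ℕ → ℝ := fun k => 2 ^ (k + 1) * r
  have hR : ∀ k, 0 < R k := fun k => by positivity
  let g : ℕ → Fin m → Rn n → ℝ≥0∞ := fun k j y =>
    weightMeasure (ω j) (ball y (R k)) ^ (θ j * δ) *
      lebesgueNorm (Q j) (ω j) ((ball y (R k)).indicator (f j))
  have hgm : ∀ k j, Measurable (g k j) := fun k j =>
    ((measurable_measure_ball _).pow_const _).mul
      (measurable_lebesgueNorm_indicator_ball (hQ0 j) _ _ _)
  have hgM : ∀ k j, eLpNorm (g k j) (P j) volume ≤ amalgamNorm (Q j) (ω j) (P j) (A j) (f j) := by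
    intro k j
    have h1 := le_iSup₂ (f := fun (r : ℝ) (_ : 0 < r) => eLpNorm (fun y : Rn n =>
      weightMeasure (ω j) (ball y r) ^ (1 / A j - 1 / Q j - 1 / (P j).toReal)
        * lebesgueNorm (Q j) (ω j) ((ball y r).indicator (f j))) (P j) volume) (R k) (hR k)
    simp only [hδj] at h1
    refine h1.trans (le_of_eq ?_)
    simp only [amalgamNorm, amalgamOf, hδj]
  have hgprod : ∀ k, eLpNorm (fun y => ∏ j, g k j y) p volume ≤
      ∏ j, amalgamNorm (Q j) (ω j) (P j) (A j) (f j) := fun k =>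
    (eLpNorm_prod_le hp0 hθ hθ1 hQPtie (hgm k)).trans
      (Finset.prod_le_prod' fun j _ => hgM k j)
  have hsum := hCL (μ := (volume : Measure (Rn n))) (fun k y => ∏ j, g k j y) _
    (fun k => Finset.measurable_fun_prod _ fun j _ => hgm k j) hgprod
  set H : Rn n → ℝ≥0∞ :=
    fun y => ∑' k : ℕ, ((k : ℝ≥0∞) + 1) * (τ ^ k * τ ^ k) * ∏ j, g k j y with hH
  have hfin : ∀ᵐ y ∂(volume : Measure (Rn n)), ∀ j,
      lebesgueNorm (Q j) (ω j) ((ball y (2 * r)).indicator (f j)) < ∞ :=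
    ae_all_iff.2 fun j => ae_lebesgueNorm_indicator_ball_lt_top (hQ0 j) (hω' j) (hP0 j) (hf j)
      (by positivity)
  have hpt : ∀ᵐ y ∂(volume : Measure (Rn n)),
      ν (ball y r) ^ δ * N ((ball y r).indicator (T f)) ≤
        (CN * CD * (C₀ + C₁ * Ch) : ℝ≥0) * H y := by
    filter_upwards [hfin] with y hy
    set S : ℝ≥0∞ := ∑' k : ℕ, (k : ℝ≥0∞) * ∏ j, ((volume (ball y (R k)))⁻¹ *
              ∫⁻ z in ball y (R k), ‖f j z‖ₑ ^ s) ^ (1 / s) with hS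
    have hlocal := hC₀ (fun j => (ball y (2 * r)).indicator (f j))
      fun j => ⟨(hf j).1.indicator measurableSet_ball, hy j⟩
    -- The local parts give the term with index zero.
    have hT1 : ν (ball y r) ^ δ * N (T fun j => (ball y (2 * r)).indicator (f j)) ≤
        CD * C₀ * H y := by
      have h0 : ∏ j, g 0 j y ≤ H y := by
        refine le_trans (le_of_eq ?_) (ENNReal.le_tsum 0)
        simp
      calc _ ≤ (CD * ∏ j, weightMeasure (ω j) (ball y (R 0)) ^ (θ j * δ)) *
            (C₀ * ∏ j, lebesgueNorm (Q j) (ω j) ((ball y (R 0)).indicator (f j))) := by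
            have hR0 : R 0 = 2 * r := by simp [R]
            refine mul_le_mul' (hballs y r (R 0) hr (hR 0) hR0.le) ?_
            rw [hR0]
            exact hlocal.2
        _ = CD * C₀ * ∏ j, g 0 j y := by simp only [g, Finset.prod_mul_distrib]; ring
        _ ≤ _ := by gcongr
    -- Reverse doubling makes the off-diagonal terms decay.
    have hT2 : ν (ball y r) ^ δ * (S * ν (ball y r) ^ (1 / q)) ≤ CD * Ch * H y := by
      have hδκ : δ + 1 / q = κ := by rw [hδdef, hκdef]; ring
      calc ν (ball y r) ^ δ * (S * ν (ball y r) ^ (1 / q)) = ν (ball y r) ^ κ * S := by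
            rw [mul_left_comm, ← ENNReal.rpow_add _ _ (hν0 y hr) (hνt y r), hδκ, mul_comm]
        _ = ∑' k : ℕ, ν (ball y r) ^ κ * ((k : ℝ≥0∞) * ∏ j, ((volume (ball y (R k)))⁻¹ *
              ∫⁻ z in ball y (R k), ‖f j z‖ₑ ^ s) ^ (1 / s)) := by rw [ENNReal.tsum_mul_left]
        _ ≤ ∑' k : ℕ, CD * Ch * (((k : ℝ≥0∞) + 1) * (τ ^ k * τ ^ k) * ∏ j, g k j y) := by
            refine ENNReal.tsum_le_tsum fun k => ?_
            have hk1 : ν (ball y r) ^ κ ≤ τ ^ k * τ ^ k * ν (ball y (R k)) ^ κ := by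
              refine (ENNReal.rpow_le_rpow (hρ (k + 1) y r hr) hκ.le).trans ?_
              rw [ENNReal.mul_rpow_of_nonneg _ _ hκ.le, ← hτ2]
              gcongr ?_ ^ κ * _
              exact pow_le_pow_of_le_one zero_le (by exact_mod_cast hρ1.le) (Nat.le_succ k)
            have hk2 := hCh f (fun j => (hf j).1) y (R k) (hR k)
            calc _ ≤ τ ^ k * τ ^ k * ν (ball y (R k)) ^ κ * (((k : ℝ≥0∞) + 1) *
                    (Ch * ν (ball y (R k)) ^ (-(1 / q)) *
                      ∏ j, lebesgueNorm (Q j) (ω j) ((ball y (R k)).indicator (f j)))) := by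
                  gcongr
                  exact le_self_add
              _ = ((k : ℝ≥0∞) + 1) * (τ ^ k * τ ^ k) * Ch * (ν (ball y (R k)) ^ δ *
                    ∏ j, lebesgueNorm (Q j) (ω j) ((ball y (R k)).indicator (f j))) := by
                  rw [show δ = κ + -(1 / q) by rw [← hδκ]; ring,
                    ENNReal.rpow_add _ _ (hν0 y (hR k)) (hνt y (R k))]
                  ring
              _ ≤ ((k : ℝ≥0∞) + 1) * (τ ^ k * τ ^ k) * Ch * ((CD *
                    ∏ j, weightMeasure (ω j) (ball y (R k)) ^ (θ j * δ)) *
                    ∏ j, lebesgueNorm (Q j) (ω j) ((ball y (R k)).indicator (f j))) := by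
                  gcongr
                  exact hballs y (R k) (R k) (hR k) (hR k) (by linarith [hR k])
              _ = _ := by simp only [g, Finset.prod_mul_distrib]; ring
        _ = CD * Ch * H y := by rw [ENNReal.tsum_mul_left]
    calc _ ≤ ν (ball y r) ^ δ * (CN * (N (T fun j => (ball y (2 * r)).indicator (f j)) +
          C₁ * S * ν (ball y r) ^ (1 / q))) := by
          gcongr
          exact hCN _ _ y r _ (hC₁ f hf y r hr)
      _ = CN * (ν (ball y r) ^ δ * N (T fun j => (ball y (2 * r)).indicator (f j)) +
          C₁ * (ν (ball y r) ^ δ * (S * ν (ball y r) ^ (1 / q)))) := by ring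
      _ ≤ CN * (CD * C₀ * H y + C₁ * (CD * Ch * H y)) := by gcongr
      _ = _ := by push_cast; ring
  refine (eLpNorm_le_nnreal_smul_eLpNorm_of_ae_le_mul' (g := H) (p := p)
    (c := CN * CD * (C₀ + C₁ * Ch)) ?_).trans ?_
  · simpa only [enorm_eq_self] using hpt
  · rw [ENNReal.smul_def, smul_eq_mul, ENNReal.coe_mul (CN * CD * (C₀ + C₁ * Ch)) CL,
      mul_assoc (ENNReal.ofNNReal _)]
    exact mul_le_mul_right hsum _

end WeightedAmalgam

end

theorem mainTheorem1 {𝕜 : Type*} [RCLike 𝕜] (n m : ℕ) (hn : 1 ≤ n) (hm : 1 ≤ m)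
    (s : ℝ) (Q A : Fin m → ℝ) (P : Fin m → ℝ≥0∞) (q α : ℝ) (p : ℝ≥0∞)
    (hs : 1 ≤ s) (hsQ : ∀ j, s ≤ Q j) (hQA : ∀ j, Q j ≤ A j)
    (hAP : ∀ j, ENNReal.ofReal (A j) < P j)
    (hq : 1 / q = ∑ j, 1 / Q j) (hp : p⁻¹ = ∑ j, (P j)⁻¹) (hα : 1 / α = ∑ j, 1 / A j)
    (hQPtie : ∀ j, (P j)⁻¹ = ENNReal.ofReal (q / Q j) * p⁻¹)
    (hQAtie : ∀ j, q / Q j = α / A j)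
    (ω : Fin m → WeightedAmalgam.Rn n → ℝ≥0∞)
    (hω : WeightedAmalgam.IsMultipleAp (fun j => Q j / s) ω)
    (hω' : ∀ j, WeightedAmalgam.IsAInfty (ω j))
    (T : (Fin m → WeightedAmalgam.Rn n → 𝕜) → WeightedAmalgam.Rn n → 𝕜)
    (hT : WeightedAmalgam.IsMultisublinearOn
      (fun j => WeightedAmalgam.sumSpace 𝕜 (Q j) (ω j) (P j) (A j)) T)
    (hTs : WeightedAmalgam.OffDiagonalCondition s
      (fun j => WeightedAmalgam.sumSpace 𝕜 (Q j) (ω j) (P j) (A j)) T) :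
    ((∀ j, 1 < Q j) →
      WeightedAmalgam.IsBoundedOperator
        (fun j => WeightedAmalgam.lebesgueNorm (Q j) (ω j))
        (WeightedAmalgam.lebesgueNorm q (WeightedAmalgam.productWeight q Q ω)) T →
      WeightedAmalgam.IsBoundedOperator
        (fun j => WeightedAmalgam.amalgamNorm (Q j) (ω j) (P j) (A j))
        (WeightedAmalgam.amalgamNorm q (WeightedAmalgam.productWeight q Q ω) p α) T) ∧
    ((∃ j, Q j = 1) →
      WeightedAmalgam.IsBoundedOperator
        (fun j => WeightedAmalgam.lebesgueNorm (Q j) (ω j))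
        (WeightedAmalgam.weakLebesgueNorm q (WeightedAmalgam.productWeight q Q ω)) T →
      WeightedAmalgam.IsBoundedOperator
        (fun j => WeightedAmalgam.amalgamNorm (Q j) (ω j) (P j) (A j))
        (WeightedAmalgam.weakAmalgamNorm q (WeightedAmalgam.productWeight q Q ω) p α) T) := by
  have hq0 : 0 < q := by
    rw [← one_div_pos, hq]
    exact Finset.sum_pos (fun j _ => one_div_pos.2 (by linarith [hsQ j])) ⟨⟨0, hm⟩, by simp⟩
  exact ⟨fun _ hTN => WeightedAmalgam.isBoundedOperator_amalgamOf hn hm hs hsQ hQA hAP hq hp hα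
      hQPtie hQAtie hω hω' hT hTs
      (WeightedAmalgam.isLocallyQuasiAdditive_lebesgueNorm hq0 _) hTN,
    fun _ hTN => WeightedAmalgam.isBoundedOperator_amalgamOf hn hm hs hsQ hQA hAP hq hp hα
      hQPtie hQAtie hω hω' hT hTs
      (WeightedAmalgam.isLocallyQuasiAdditive_weakLebesgueNorm hq0 _) hTN⟩
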